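/- Let $k,n$ be integers with $2\le k\le n-2$, let $[t]=\{1,\dots,t\}$ (with $[0]=\emptyset$), and identify $[n]$ with $\mathbb Z/n\mathbb Z$. Let $\sigma:x\mapsto x+1$ and $\rho:x\mapsto n+1-x$, as permutations of $[n]$. The checkboard graph $G^{\mathrm{ch}}_{k,n}$ is identified with the collection of its face labels $$I^{\mathrm{ch}}_{i,j}=\sigma^{-\lceil (i+j)/2\rceil}\big(([i+j]\setminus[i])\cup([n]\setminus[n-k+j])\big),\qquad 0\le i\le n-k,\ 0\le j\le k,$$ and the dual checkboard graph $\widehat G^{\mathrm{ch}}_{k,n}$ is the collection of the complements (in $[n]$) of the face labels of $G^{\mathrm{ch}}_{n-k,n}$. Permutations act on graphs through their face labels, and the right labels of a graph are the complements of its face labels. For $0\le i\le k$, $0\le j\le n-k$ let $\hat J^{\mathrm{ch}}_{i,j}$ be the complement of $$\hat I^{\mathrm{ch}}_{i,j}=\sigma^{-\lceil (i+j)/2\rceil}\big([i]\cup([k+j]\setminus[i+j])\big).$$ Let $\check{\mathbb X}=\mathrm{Gr}_{n-k,n}$ be the Grassmannian of $(n-k)$-dimensional subspaces of $\mathbb C^n$,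 with Plücker coordinates $p_J$ ($J\subseteq[n]$, $|J|=n-k$), where $p_J$ is the maximal minor with column set $J$ of a matrix whose rows form a basis of the subspace. For $i\in\mathbb Z$ let, modulo $n$, $J_i=\{i+1,\dots,i+n-k\}$ and $J_i^+=\{i+1,\dots,i+n-k-1\}\cup\{i+n-k+1\}$. Let $\check{\mathbb X}^\circ$ be the locus where $p_{J_1},\dots,p_{J_n}$ do not vanish, and let $W:\check{\mathbb X}^\circ\times\mathbb C^*\to\mathbb C$ be the superpotential $$W=\sum_{i=1}^n \frac{p_{J_i^+}}{p_{J_i}}\,q^{\delta_{i,k}}.$$ Let $m\in[n]$ and let $G=\sigma^m\rho\,\widehat G^{\mathrm{ch}}_{k,n}$. Then the right labels of $G$ are exactly the sets $$\sigma^m\rho\,\hat J^{\mathrm{ch}}_{j,i}=\sigma^{\lceil (i+j)/2\rceil+m}\big([n-k-i]\cup([n-j]\setminus[n-i-j])\big),\qquad 0\le i\le n-k,\ 0\le j\le k,$$ where the displayed equality holds for all these $i,j$. Moreover, writing $y_{i,j}$ for the Plücker coordinate of $\check{\mathbb X}$ labelled by $\sigma^m\rho\,\hat J^{\mathrm{ch}}_{j,i}$,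 on the open subset of $\check{\mathbb X}^\circ$ where all $y_{i,j}\neq0$ (times $\mathbb C^*$) one has $$W=\frac{y_{1,k-1}}{y_{0,k}}\,q^{\delta_{m,\lfloor k/2\rfloor}}+\frac{y_{n-k-1,1}}{y_{n-k,0}}\,q^{\delta_{m,\lfloor (n+k)/2\rfloor}}+\sum_{d=1-k}^{n-k-2}\Big(\sum_{a-b=d}\frac{y_{a,b+1}\,y_{a+1,b-1}}{y_{a,b}\,y_{a+1,b}}+\sum_{a-b=d}\frac{y_{a-1,b}\,y_{a+1,b-1}}{y_{a,b-1}\,y_{a,b}}\Big)q^{\epsilon_{m,d}}$$ as functions, where each inner sum runs over all integers $a,b$ with $a-b=d$ for which the four variables occurring in its summand are defined (that is, have first index in $\{0,\dots,n-k\}$ and second index in $\{0,\dots,k\}$), and $$\epsilon_{m,d}=\delta_{m,d/2+k}+\delta_{m,-(d+1)/2}.$$ Here $\delta_{m,x}$ (for rational $x$) is $1$ if $x$ is an integer congruent to $m$ modulo $n$, and $0$ otherwise. -/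

import Mathlib

open Matrix

namespace Checkboard

noncomputable section

/-! ### Subsets of `[n]`

The ground set `[n] = {1, …, n}`, identified with `ℤ / n`, is modelled by `Fin n`:
the element `x : Fin n` stands for `x.val + 1`, so the usual order of `Fin n` is `1 < 2 < ⋯ < n`. -/

/-- The initial segment `[t] = {1, …, t}` of `[n]` (empty for `t ≤ 0`). -/
def seg (n : ℕ) (t : ℤ) : Finset (Fin n) :=
  Finset.univ.filter fun x => ((x : ℕ) : ℤ) + 1 ≤ t

/-- The set of elements of `[n]` that are congruent modulo `n` to an integer in `s`.
For `a ≤ b < a + n`, `residues n (Finset.Icc a b)` is the cyclic interval from `a` to `b`. -/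
def residues (n : ℕ) (s : Finset ℤ) : Finset (Fin n) :=
  Finset.univ.filter fun x => ∃ t ∈ s, ((x : ℕ) : ℤ) + 1 ≡ t [ZMOD n]

/-- The rotation `σ : x ↦ x + 1` of `[n]`. -/
def rot (n : ℕ) : Equiv.Perm (Fin n) := finRotate n

/-- The reflection `ρ : x ↦ n + 1 - x` of `[n]`. -/
def refl (n : ℕ) : Equiv.Perm (Fin n) := Fin.revPerm

/-- The image `π(J)` of a subset `J ⊆ [n]` under a permutation `π`. -/
def act {n : ℕ} (π : Equiv.Perm (Fin n)) (J : Finset (Fin n)) : Finset (Fin n) :=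
  J.image π

/-- `⌈(i + j) / 2⌉`. -/
def halfCeil (i j : ℤ) : ℤ := ⌈((i + j : ℤ) : ℚ) / 2⌉

/-! ### (Dual) checkboard graphs, given by their face labels -/

/-- The face label `I_{i,j}` of the checkboard graph of type `(k, n)`. -/
def checkLabel (n : ℕ) (k i j : ℤ) : Finset (Fin n) :=
  act (rot n ^ (-halfCeil i j)) (seg n (i + j) \ seg n i) ∪
    act (rot n ^ (-halfCeil i j)) (seg n n \ seg n (n - k + j))

/-- The checkboard graph of type `(k, n)`, as the collection of its face labels; the indices
`i ∈ {0, n - k}` and `j ∈ {0, k}` give the frozen labels. -/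
def checkboard (n : ℕ) (k : ℤ) : Set (Finset (Fin n)) :=
  {I | ∃ i j : ℤ, 0 ≤ i ∧ i ≤ n - k ∧ 0 ≤ j ∧ j ≤ k ∧ I = checkLabel n k i j}

/-- The dual checkboard graph of type `(k, n)`: its face labels are the complements of the
face labels of the checkboard graph of type `(n - k, n)`. -/
def dualCheckboard (n : ℕ) (k : ℤ) : Set (Finset (Fin n)) :=
  {I | ∃ I' ∈ checkboard n (n - k), I = I'ᶜ}

/-- The action of a permutation on a graph, seen as a collection of face labels. -/
def actGraph {n : ℕ} (π : Equiv.Perm (Fin n)) (G : Set (Finset (Fin n))) :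
    Set (Finset (Fin n)) :=
  {I | ∃ I' ∈ G, I = act π I'}

/-- The right labels of a graph: the complements of its face labels. -/
def rightLabels {n : ℕ} (G : Set (Finset (Fin n))) : Set (Finset (Fin n)) :=
  {J | ∃ I ∈ G, J = Iᶜ}

/-- The face label `Î_{i,j}` of the dual checkboard graph of type `(k, n)`, where
`0 ≤ i ≤ k` and `0 ≤ j ≤ n - k`. -/
def dualCheckLabel (n : ℕ) (k i j : ℤ) : Finset (Fin n) :=
  act (rot n ^ (-halfCeil i j)) (seg n i) ∪
    act (rot n ^ (-halfCeil i j)) (seg n (k + j) \ seg n (i + j))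

/-- The right label `Ĵ_{i,j}`, the complement of `Î_{i,j}`. -/
def dualCheckRightLabel (n : ℕ) (k i j : ℤ) : Finset (Fin n) := (dualCheckLabel n k i j)ᶜ

/-- The label `σ^m ρ Ĵ_{j,i}`, where `0 ≤ i ≤ n - k` and `0 ≤ j ≤ k`. -/
def reflLabel (n : ℕ) (k m i j : ℤ) : Finset (Fin n) :=
  act (rot n ^ m * refl n) (dualCheckRightLabel n k j i)

/-! ### Grassmannians, Plücker coordinates and the superpotential -/

/-- The Grassmannian `Gr_{r,n}` of `r`-dimensional subspaces of `ℂ^n`. -/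
def Gr (r n : ℕ) : Type := {V : Submodule ℂ (Fin n → ℂ) // Module.finrank ℂ V = r}

/-- The rows of the matrix `A` form a basis of the subspace `V`. -/
def Represents {r n : ℕ} (A : Matrix (Fin r) (Fin n) ℂ) (V : Gr r n) : Prop :=
  LinearIndependent ℂ A.row ∧ Submodule.span ℂ (Set.range A.row) = V.1

/-- The Plücker coordinate `p_J(A)`: the maximal minor of `A` with column set `J` (columns in
increasing order). The value for `J` of the wrong cardinality is irrelevant. -/
def plucker {r n : ℕ} (A : Matrix (Fin r) (Fin n) ℂ) (J : Finset (Fin n)) : ℂ :=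
  if h : J.card = r then (A.submatrix id (J.orderEmbOfFin h)).det else 0

/-- `J_i`, the cyclic interval from `i + 1` to `i + n - k`. -/
def frozenLabel (n : ℕ) (k i : ℤ) : Finset (Fin n) :=
  residues n (Finset.Icc (i + 1) (i + n - k))

/-- `J_i⁺`, the cyclic interval from `i + 1` to `i + n - k - 1` together with `i + n - k + 1`. -/
def frozenLabelPlus (n : ℕ) (k i : ℤ) : Finset (Fin n) :=
  residues n (Finset.Icc (i + 1) (i + n - k - 1)) ∪ residues n {i + n - k + 1}

/-- A matrix whose rows are a chosen basis of `V`. -/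
def basisMatrix {r n : ℕ} (V : Gr r n) : Matrix (Fin r) (Fin n) ℂ :=
  Matrix.of fun s => ((Module.finBasisOfFinrankEq ℂ V.1 V.2 s : V.1) : Fin n → ℂ)

/-- The open subset of `Gr_{n-k,n}` where none of `p_{J_1}, …, p_{J_n}` vanishes. -/
def OpenGr (k n : ℕ) : Set (Gr (n - k) n) :=
  {V | ∀ i ∈ Finset.Icc 1 n, plucker (basisMatrix V) (frozenLabel n k i) ≠ 0}

/-- `∑_{i=1}^n p_{J_i⁺}/p_{J_i} q^{δ_{i,k}}`, evaluated on a matrix. -/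
def superpotentialOn (k n : ℕ) (A : Matrix (Fin (n - k)) (Fin n) ℂ) (q : ℂ) : ℂ :=
  ∑ i ∈ Finset.Icc 1 n,
    plucker A (frozenLabelPlus n k i) / plucker A (frozenLabel n k i) * q ^ (if i = k then 1 else 0)

/-- The superpotential `W`, a function on `OpenGr k n × ℂˣ`. -/
def superpotential (k n : ℕ) (V : OpenGr k n) (q : ℂˣ) : ℂ :=
  superpotentialOn k n (basisMatrix V.1) q

/-! ### The explicit formula -/

open Classical in
/-- The Kronecker delta `δ_{m,x}` modulo `n`, for an integer `m` and a rational number `x`: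
it is `1` if `x` is an integer congruent to `m` modulo `n`, and `0` otherwise. -/
def cycDelta (n : ℕ) (m : ℤ) (x : ℚ) : ℕ :=
  if ∃ z : ℤ, x = z ∧ m ≡ z [ZMOD n] then 1 else 0

/-- `ε_{m,d} = δ_{m,d/2+k} + δ_{m,-(d+1)/2}`. -/
def eps (k n : ℕ) (m d : ℤ) : ℕ :=
  cycDelta n m ((d : ℚ) / 2 + k) + cycDelta n m (-((d : ℚ) + 1) / 2)

/-- `y_{i,j}` is defined, i.e. `0 ≤ i ≤ n - k` and `0 ≤ j ≤ k`. -/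
def InGrid (k n : ℕ) (i j : ℤ) : Prop := 0 ≤ i ∧ i ≤ (n : ℤ) - k ∧ 0 ≤ j ∧ j ≤ k

instance (k n : ℕ) (i j : ℤ) : Decidable (InGrid k n i j) := by
  unfold InGrid; infer_instance

/-- All pairs `(a, b)` with `0 ≤ a ≤ n - k` and `0 ≤ b ≤ k`. -/
def grid (k n : ℕ) : Finset (ℤ × ℤ) := Finset.Icc 0 ((n : ℤ) - k) ×ˢ Finset.Icc 0 (k : ℤ)

/-- `∑_{a-b=d} y_{a,b+1} y_{a+1,b-1} / (y_{a,b} y_{a+1,b})`, over all `a, b` for which the four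
variables are defined. -/
def diagSum₁ (k n : ℕ) (y : ℤ → ℤ → ℂ) (d : ℤ) : ℂ :=
  ∑ p ∈ (grid k n).filter (fun p => p.1 - p.2 = d ∧
      InGrid k n p.1 (p.2 + 1) ∧ InGrid k n (p.1 + 1) (p.2 - 1) ∧
      InGrid k n p.1 p.2 ∧ InGrid k n (p.1 + 1) p.2),
    (y p.1 (p.2 + 1) * y (p.1 + 1) (p.2 - 1)) / (y p.1 p.2 * y (p.1 + 1) p.2)

/-- `∑_{a-b=d} y_{a-1,b} y_{a+1,b-1} / (y_{a,b-1} y_{a,b})`, over all `a, b` for which the four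
variables are defined. -/
def diagSum₂ (k n : ℕ) (y : ℤ → ℤ → ℂ) (d : ℤ) : ℂ :=
  ∑ p ∈ (grid k n).filter (fun p => p.1 - p.2 = d ∧
      InGrid k n (p.1 - 1) p.2 ∧ InGrid k n (p.1 + 1) (p.2 - 1) ∧
      InGrid k n p.1 (p.2 - 1) ∧ InGrid k n p.1 p.2),
    (y (p.1 - 1) p.2 * y (p.1 + 1) (p.2 - 1)) / (y p.1 (p.2 - 1) * y p.1 p.2)

/-! ### `W` does not depend on the chosen basis -/

theorem plucker_mul {r n : ℕ} (g : Matrix (Fin r) (Fin r) ℂ) (A : Matrix (Fin r) (Fin n) ℂ)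
    (J : Finset (Fin n)) : plucker (g * A) J = g.det * plucker A J := by
  unfold plucker
  split_ifs with h
  · rw [← Matrix.det_mul]
    congr 1
  · simp

theorem represents_basisMatrix {r n : ℕ} (V : Gr r n) : Represents (basisMatrix V) V := by
  have hb : (basisMatrix V).row =
      V.1.subtype ∘ (Module.finBasisOfFinrankEq ℂ V.1 V.2) := rfl
  refine ⟨?_, ?_⟩
  · rw [hb]
    exact (Module.finBasisOfFinrankEq ℂ V.1 V.2).linearIndependent.map'
      _ (Submodule.ker_subtype _)
  · rw [hb, Set.range_comp, Submodule.span_image, Module.Basis.span_eq, Submodule.map_subtype_top]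

theorem exists_mul_of_span_le {r n : ℕ} {A B : Matrix (Fin r) (Fin n) ℂ}
    (h : Submodule.span ℂ (Set.range A.row) ≤ Submodule.span ℂ (Set.range B.row)) :
    ∃ g : Matrix (Fin r) (Fin r) ℂ, A = g * B := by
  have h1 : ∀ s, ∃ c : Fin r → ℂ, ∑ t, c t • B.row t = A.row s := fun s =>
    (Submodule.mem_span_range_iff_exists_fun ℂ).1 (h (Submodule.subset_span ⟨s, rfl⟩))
  choose c hc using h1
  refine ⟨Matrix.of c, ?_⟩
  ext s x
  have := congrFun (hc s) x
  simp [Matrix.mul_apply, Finset.sum_apply] at this ⊢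
  exact this.symm

/-- Two matrices representing the same subspace have proportional Plücker coordinates. -/
theorem Represents.exists_plucker {r n : ℕ} {A B : Matrix (Fin r) (Fin n) ℂ} {V : Gr r n}
    (hA : Represents A V) (hB : Represents B V) :
    ∃ c : ℂ, c ≠ 0 ∧ ∀ J, plucker A J = c * plucker B J := by
  obtain ⟨g, hg⟩ := exists_mul_of_span_le (hA.2.trans hB.2.symm).le
  obtain ⟨h, hh⟩ := exists_mul_of_span_le (hB.2.trans hA.2.symm).le
  refine ⟨g.det, ?_, fun J => by rw [hg, plucker_mul]⟩
  have h1 : (g * h) * A = (1 : Matrix (Fin r) (Fin r) ℂ) * A := by rw [Matrix.mul_assoc, ← hh, ← hg, Matrix.one_mul]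
  have h2 : g * h = 1 := by
    have hinj := Matrix.vecMul_injective_iff.2 hA.1
    ext s t
    have : (g * h) s = (1 : Matrix (Fin r) (Fin r) ℂ) s := by
      apply hinj
      have := congrFun h1 s
      simpa [Matrix.mul_apply_eq_vecMul] using this
    rw [this]
  intro h0
  have := congrArg Matrix.det h2
  rw [Matrix.det_mul, h0] at this
  simp at this

/-- `W` can be computed from any matrix whose rows form a basis of the subspace. -/
theorem superpotential_eq {k n : ℕ} (V : OpenGr k n) (q : ℂˣ)
    {A : Matrix (Fin (n - k)) (Fin n) ℂ} (hA : Represents A V.1) :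
    superpotential k n V q = superpotentialOn k n A q := by
  obtain ⟨c, hc, h⟩ := (represents_basisMatrix V.1).exists_plucker hA
  unfold superpotential superpotentialOn
  refine Finset.sum_congr rfl fun i _ => ?_
  rw [h, h, mul_div_mul_left _ _ hc]

end

end Checkboard

/-! Write `r = n - k`. The chart coordinates `y a b` are indexed by a grid, and each of its
diagonals `a - b = d` with `1 - k ≤ d ≤ r - 2` accounts for exactly one summand `p_{J_i⁺} / p_{J_i}`
of `W`; the two corner quotients account for the remaining two. Modulo `n`, the index is `i = m - d
/ 2` for even `d` and `i = m + k + (d + 1) / 2` for odd `d` (`diagIndex`).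

On a fixed diagonal the two kinds of summand alternate and form a telescoping sum. The interpolating
quantities `evenRatio` and `oddRatio` are quotients `p_{J'} / p_J`: the denominator is a chart
coordinate, whose label `J` is a union of two cyclic intervals, and the numerator moves the right
end of one of these intervals a step further. Two neighbouring ratios differ by one summand of the
diagonal; this is a three-term Plücker relation (`cycPlucker_three_term_Ioc`). At one end of the
diagonal `J` is a single cyclic interval and the ratio is `p_{J_i⁺} / p_{J_i}`. At the other end the
numerator's label has the wrong cardinality, so the ratio is zero. Even diagonals start at the
frozen ratio and end at zero, odd diagonals the reverse (`diagSum_even`, `diagSum_odd`).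

Since `d ↦ i` is a bijection from `-k, …, r - 1` onto the residues modulo `n`, summing over `d`
gives `W`. The exponent of `q` is correct because `ε_{m,d}` tests whether `i ≡ k`. -/

namespace Checkboard

/-! ### Permutations and cyclic intervals in `ℤ / n` -/

theorem mem_seg {n : ℕ} {t : ℤ} {x : Fin n} : x ∈ seg n t ↔ ((x : ℕ) : ℤ) + 1 ≤ t := by
  simp [seg]

theorem mem_residues {n : ℕ} {S : Finset ℤ} {x : Fin n} :
    x ∈ residues n S ↔ ∃ t ∈ S, ((x : ℕ) : ℤ) + 1 ≡ t [ZMOD n] := by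
  simp [residues]

theorem mem_act {n : ℕ} {π : Equiv.Perm (Fin n)} {J : Finset (Fin n)} {x : Fin n} :
    x ∈ act π J ↔ π.symm x ∈ J := by
  simp only [act, Finset.mem_image]
  constructor
  · rintro ⟨a, ha, rfl⟩
    simpa using ha
  · intro h
    exact ⟨_, h, by simp⟩

theorem act_mul {n : ℕ} (π τ : Equiv.Perm (Fin n)) (J : Finset (Fin n)) :
    act (π * τ) J = act π (act τ J) := by
  ext x
  simp only [mem_act]
  rfl

theorem act_union {n : ℕ} (π : Equiv.Perm (Fin n)) (J K : Finset (Fin n)) :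
    act π (J ∪ K) = act π J ∪ act π K := by
  ext x
  simp only [mem_act, Finset.mem_union]

theorem act_compl {n : ℕ} (π : Equiv.Perm (Fin n)) (J : Finset (Fin n)) :
    act π Jᶜ = (act π J)ᶜ := by
  ext x
  simp only [mem_act, Finset.mem_compl]

theorem halfCeil_eq (i j : ℤ) : halfCeil i j = (i + j + 1) / 2 := by
  unfold halfCeil
  rw [Int.ceil_eq_iff]
  have h1 := Int.emod_add_mul_ediv (i + j + 1) 2
  have h2 : ((i + j + 1) % 2 : ℤ) = 0 ∨ (i + j + 1) % 2 = 1 := by omega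
  generalize (i + j + 1) / 2 = c at *
  rcases h2 with h2 | h2 <;> rw [h2] at h1 <;>
    have h3 : i + j = 2 * c - 1 ∨ i + j = 2 * c := by omega
  all_goals
    rcases h3 with h3 | h3 <;> rw [h3] <;> push_cast <;> constructor <;> linarith

theorem rot_apply_modEq {n : ℕ} (x : Fin n) :
    ((rot n x : ℕ) : ℤ) ≡ ((x : ℕ) : ℤ) + 1 [ZMOD n] := by
  obtain _ | n := n
  · exact x.elim0
  · rw [rot, finRotate_apply, Fin.val_add]
    have : ((1 : Fin (n + 1)) : ℕ) = 1 % (n + 1) := rfl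
    rw [this]
    push_cast
    exact (Int.mod_modEq _ _).trans (Int.ModEq.add_left _ (Int.mod_modEq _ _))

theorem rot_zpow_apply_modEq {n : ℕ} (z : ℤ) (x : Fin n) :
    (((rot n ^ z) x : ℕ) : ℤ) ≡ ((x : ℕ) : ℤ) + z [ZMOD n] := by
  induction z generalizing x with
  | zero => simp
  | succ i ih =>
    rw [_root_.zpow_add_one, Equiv.Perm.mul_apply]
    refine (ih _).trans ?_
    rw [add_comm (i : ℤ) 1, ← add_assoc]
    exact (rot_apply_modEq x).add_right _
  | pred i ih =>
    rw [_root_.zpow_sub_one, Equiv.Perm.mul_apply]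
    refine (ih _).trans ?_
    have h := rot_apply_modEq ((rot n)⁻¹ x)
    rw [← Equiv.Perm.mul_apply, mul_inv_cancel, Equiv.Perm.one_apply] at h
    have h2 := h.add_right (-(i : ℤ) - 1)
    convert h2.symm using 1
    ring

theorem fin_eq_of_modEq {n : ℕ} {x y : Fin n} (h : ((x : ℕ) : ℤ) ≡ ((y : ℕ) : ℤ) [ZMOD n]) :
    x = y := by
  apply Fin.ext
  have hx : ((x : ℕ) : ℤ) % n = (x : ℕ) := Int.emod_eq_of_lt (by omega) (by omega)
  have hy : ((y : ℕ) : ℤ) % n = (y : ℕ) := Int.emod_eq_of_lt (by omega) (by omega)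
  unfold Int.ModEq at h
  omega

theorem refl_mul_rot_zpow (n : ℕ) (z : ℤ) : refl n * rot n ^ (-z) = rot n ^ z * refl n := by
  ext1 x
  apply fin_eq_of_modEq
  simp only [Equiv.Perm.mul_apply]
  refine Int.ModEq.trans ?_ (rot_zpow_apply_modEq z _).symm
  have h := rot_zpow_apply_modEq (-z) x
  simp only [refl, Fin.revPerm_apply, Fin.val_rev]
  have h1 := ((rot n ^ (-z)) x).isLt
  have h2 := x.isLt
  push_cast [Nat.cast_sub (show ((rot n ^ (-z)) x : ℕ) + 1 ≤ n from h1),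
    Nat.cast_sub (show (x : ℕ) + 1 ≤ n from h2)]
  convert ((Int.ModEq.refl (n - 1 : ℤ)).sub h) using 1 <;> ring

theorem act_rot_zpow_residues (n : ℕ) (z : ℤ) (S : Finset ℤ) :
    act (rot n ^ z) (residues n S) = residues n (S.image (· + z)) := by
  ext x
  have h := rot_zpow_apply_modEq z ((rot n ^ z).symm x)
  rw [Equiv.apply_symm_apply] at h
  simp only [mem_act, mem_residues, Finset.mem_image, exists_exists_and_eq_and]
  refine exists_congr fun t => and_congr_right fun _ => ?_
  rw [Int.modEq_iff_dvd, Int.modEq_iff_dvd, ← dvd_add_right (Int.modEq_iff_dvd.1 h)]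
  ring_nf

theorem residues_union (n : ℕ) (S T : Finset ℤ) :
    residues n (S ∪ T) = residues n S ∪ residues n T := by
  ext x
  simp only [mem_residues, Finset.mem_union, or_and_right, exists_or]

theorem residues_image_add_mul (n : ℕ) (S : Finset ℤ) (c : ℤ) :
    residues n (S.image (· + n * c)) = residues n S := by
  ext x
  simp only [mem_residues, Finset.mem_image, exists_exists_and_eq_and]
  refine exists_congr fun t => and_congr_right fun _ => ?_
  simp [Int.modEq_iff_dvd, add_sub_right_comm]

theorem seg_sdiff_seg (n : ℕ) {s t : ℤ} (hs : 0 ≤ s) (ht : t ≤ n) :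
    seg n t \ seg n s = residues n (Finset.Ioc s t) := by
  ext x
  simp only [mem_residues, Finset.mem_sdiff, mem_seg, Finset.mem_Ioc]
  have hx := x.isLt
  constructor
  · intro h
    exact ⟨_, by omega, Int.ModEq.refl _⟩
  · rintro ⟨u, hu, h⟩
    have h1 : ((x : ℕ) : ℤ) ≡ u - 1 [ZMOD n] := by simpa using h.sub_right 1
    rw [Int.ModEq, Int.emod_eq_of_lt (by omega) (by omega),
      Int.emod_eq_of_lt (by omega) (by omega)] at h1
    omega

theorem seg_eq (n : ℕ) {t : ℤ} (ht : t ≤ n) : seg n t = residues n (Finset.Ioc 0 t) := by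
  rw [← seg_sdiff_seg n le_rfl ht]
  ext x
  simp only [Finset.mem_sdiff, mem_seg]
  omega

/-- Reduction modulo `n` is injective on a set of integers of diameter less than `n`. The hypothesis
covers both orders of each pair, so it bounds the absolute value; for `n = 0` it forces `S` to be
empty. -/
theorem card_residues {n : ℕ} {S : Finset ℤ} (hS : ∀ s ∈ S, ∀ t ∈ S, s - t < n) :
    (residues n S).card = S.card := by
  obtain rfl | hn := n.eq_zero_or_pos
  · have : S = ∅ := Finset.eq_empty_of_forall_notMem fun s hs => by simpa using hS s hs s hs
    subst this
    rfl
  have hn' : (n : ℤ) ≠ 0 := by omega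
  have hlt (t : ℤ) : ((t - 1) % n).toNat < n := by
    have h1 := Int.emod_nonneg (t - 1) hn'
    have h2 := Int.emod_lt_of_pos (t - 1) (show (0 : ℤ) < n by omega)
    omega
  have hval (t : ℤ) : (((t - 1) % n).toNat : ℤ) = (t - 1) % n :=
    Int.toNat_of_nonneg (Int.emod_nonneg _ hn')
  symm
  refine Finset.card_bij (fun t _ => ⟨((t - 1) % n).toNat, hlt t⟩) ?_ ?_ ?_
  · intro t ht
    rw [mem_residues]
    refine ⟨t, ht, ?_⟩
    rw [hval]
    simpa using (Int.mod_modEq (t - 1) n).add_right 1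
  · intro s hs t ht h
    have h1 : (s - 1) % n = (t - 1) % n := by
      rw [← hval, ← hval t]
      exact congrArg (fun x : Fin n => ((x : ℕ) : ℤ)) h
    obtain ⟨c, hc⟩ := Int.ModEq.dvd (show s - 1 ≡ t - 1 [ZMOD n] from h1)
    have h2 := hS s hs t ht
    have h3 := hS t ht s hs
    have : c = 0 := by
      have hc1 : c < 1 := by nlinarith
      have hc2 : -1 < c := by nlinarith
      omega
    subst this
    omega
  · intro x hx
    obtain ⟨t, ht, h⟩ := mem_residues.1 hx
    refine ⟨t, ht, fin_eq_of_modEq ?_⟩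
    rw [hval]
    have : ((x : ℕ) : ℤ) ≡ t - 1 [ZMOD n] := by simpa using h.sub_right 1
    exact (Int.mod_modEq _ _).trans this.symm

/-! ### The right labels of the reflected graph -/

theorem checkLabel_eq_dualCheckRightLabel {n : ℕ} {k : ℤ} {i j : ℤ} (hj : 0 ≤ j)
    (hik : i ≤ k) : checkLabel n (n - k) i j = dualCheckRightLabel n k i j := by
  unfold checkLabel dualCheckRightLabel dualCheckLabel
  rw [← act_union, ← act_union, ← act_compl]
  congr 1
  ext x
  have := x.isLt
  simp only [Finset.mem_union, Finset.mem_sdiff, Finset.mem_compl, mem_seg]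
  omega

theorem rightLabels_actGraph_dualCheckboard {k n : ℕ} (m : ℕ) :
    rightLabels (actGraph (rot n ^ m * refl n) (dualCheckboard n k)) =
      {J | ∃ i j : ℤ, InGrid k n i j ∧ J = reflLabel n k m i j} := by
  ext J
  constructor
  · rintro ⟨_, ⟨_, ⟨_, ⟨i, j, hi, hik, hj, hjk, rfl⟩, rfl⟩, rfl⟩, rfl⟩
    refine ⟨j, i, ⟨hj, hjk, hi, by omega⟩, ?_⟩
    rw [act_compl, compl_compl, reflLabel, checkLabel_eq_dualCheckRightLabel hj (by omega)]
    rfl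
  · rintro ⟨i, j, ⟨hi, hik, hj, hjk⟩, rfl⟩
    refine ⟨_, ⟨_, ⟨_, ⟨j, i, hj, by omega, hi, hik, rfl⟩, rfl⟩, rfl⟩, ?_⟩
    rw [act_compl, compl_compl, reflLabel, checkLabel_eq_dualCheckRightLabel hi hjk]
    rfl

/-- Reflection conjugates a rotation to its inverse, which turns the exponent of `σ` positive; what
is left is the reversal of a complement of segments. -/
theorem reflLabel_eq_act {k n : ℕ} (m : ℕ) {i j : ℤ} (h : InGrid k n i j) :
    reflLabel n k m i j =
      act (rot n ^ (halfCeil i j + m))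
        (seg n (n - k - i) ∪ (seg n (n - j) \ seg n (n - i - j))) := by
  obtain ⟨hi, hik, hj, hjk⟩ := h
  unfold reflLabel dualCheckRightLabel dualCheckLabel
  have hc : halfCeil j i = halfCeil i j := by rw [halfCeil, add_comm, halfCeil]
  rw [hc, ← act_union, ← act_compl, ← act_mul, mul_assoc, refl_mul_rot_zpow, ← mul_assoc,
    ← _root_.zpow_add, act_mul, add_comm]
  congr 1
  ext x
  have := x.isLt
  simp only [mem_act, Finset.mem_union, Finset.mem_sdiff, Finset.mem_compl, mem_seg, refl,
    Fin.revPerm_symm, Fin.revPerm_apply, Fin.val_rev]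
  omega

theorem reflLabel_eq_residues {k n : ℕ} (m : ℕ) {i j c : ℤ} (h : InGrid k n i j)
    (hc : (i + j + 1) / 2 = c) :
    reflLabel n k m i j = residues n (Finset.Ioc (c + m) (c + m + (n - k - i)) ∪
      Finset.Ioc (n - i - j + (c + m)) (n - j + (c + m))) := by
  rw [reflLabel_eq_act m h]
  obtain ⟨hi, hik, hj, hjk⟩ := h
  rw [halfCeil_eq, hc, seg_eq n (by omega), seg_sdiff_seg n (by omega) (by omega),
    ← residues_union, act_rot_zpow_residues]
  congr 1
  ext x
  simp only [Finset.mem_image, Finset.mem_union, Finset.mem_Ioc]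
  constructor
  · rintro ⟨t, ht, rfl⟩
    omega
  · intro h
    exact ⟨x - (c + m), by omega, by omega⟩

/-! ### Three-term relations between maximal minors -/

theorem plucker_of_card_ne {r n : ℕ} {A : Matrix (Fin r) (Fin n) ℂ} {J : Finset (Fin n)}
    (h : J.card ≠ r) : plucker A J = 0 := dif_neg h

/-- The minor with columns `f 0, f 1, …` in any order, up to the sign of the permutation that
sorts them. -/
theorem plucker_image {r n : ℕ} (A : Matrix (Fin r) (Fin n) ℂ) (f : Fin r → Fin n) :
    plucker A (Finset.univ.image f) =
      ((vandermonde fun i => ((f i : ℕ) : ℤ)).det.sign : ℂ) * (A.submatrix id f).det := by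
  by_cases hf : Function.Injective f
  · have hcard : (Finset.univ.image f).card = r := by
      rw [Finset.card_image_of_injective _ hf, Finset.card_univ, Fintype.card_fin]
    rw [plucker, dif_pos hcard]
    set g := (Finset.univ.image f).orderEmbOfFin hcard with hg
    have hex : ∀ i, ∃ j, g j = f i := fun i => by
      have : f i ∈ Set.range g := by
        rw [hg, Finset.range_orderEmbOfFin]
        simp
      exact this
    choose τ hτ using hex
    have hinj : Function.Injective τ := fun a b h => hf (by rw [← hτ, ← hτ, h])
    let σ : Equiv.Perm (Fin r) := Equiv.ofBijective τ (Finite.injective_iff_bijective.1 hinj)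
    have hfg : f = g ∘ σ := funext fun i => (hτ i).symm
    have h1 : (A.submatrix id f).det = Equiv.Perm.sign σ * (A.submatrix id g).det := by
      rw [← det_permute', hfg]
      rfl
    have h2 : (vandermonde fun i => ((f i : ℕ) : ℤ)).det =
        Equiv.Perm.sign σ * (vandermonde fun i => ((g i : ℕ) : ℤ)).det := by
      have h := det_permute σ (vandermonde fun i => ((g i : ℕ) : ℤ))
      rw [← Int.cast_id (n := ((Equiv.Perm.sign σ : ℤˣ) : ℤ)), ← h, hfg]
      rfl
    -- The Vandermonde determinant of increasing entries is positive, so that of `f` has the sign of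
    -- the sorting permutation.
    have h3 : 0 < (vandermonde fun i => ((g i : ℕ) : ℤ)).det := by
      rw [det_vandermonde]
      refine Finset.prod_pos fun i _ => Finset.prod_pos fun j hj => ?_
      have : g i < g j := g.strictMono (Finset.mem_Ioi.1 hj)
      have : (g i : ℕ) < g j := this
      omega
    rw [h1, h2, Int.sign_mul, Int.sign_eq_one_of_pos h3, mul_one, ← mul_assoc]
    rcases Int.units_eq_one_or (Equiv.Perm.sign σ) with h | h <;> rw [h] <;> simp
  -- For a repeated column the image is too small, so the default value `0` of `plucker` matches the
  -- vanishing determinant.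
  · rw [plucker_of_card_ne]
    · simp only [Function.Injective, not_forall] at hf
      obtain ⟨i, j, h, hij⟩ := hf
      rw [Matrix.det_zero_of_column_eq (M := A.submatrix id f) hij
        (fun s => by simp only [submatrix_apply, h]), mul_zero]
    · intro h
      apply hf
      have := Finset.card_image_iff.1 (h.trans (by simp : r = (Finset.univ : Finset (Fin r)).card))
      simpa using this

/-- The determinant with first two rows `x`, `y` and remaining rows `c`. -/
def pairDet {s : ℕ} (c : Fin s → Fin (s + 2) → ℂ) (x y : Fin (s + 2) → ℂ) : ℂ :=
  (Matrix.of (vecCons x (vecCons y c))).det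

theorem pairDet_self {s : ℕ} (c : Fin s → Fin (s + 2) → ℂ) (x : Fin (s + 2) → ℂ) :
    pairDet c x x = 0 :=
  Matrix.det_zero_of_row_eq (i := 0) (j := 1) (by simp) (by ext; simp)

theorem pairDet_left_mem {s : ℕ} (c : Fin s → Fin (s + 2) → ℂ) (i : Fin s)
    (y : Fin (s + 2) → ℂ) : pairDet c (c i) y = 0 :=
  Matrix.det_zero_of_row_eq (i := 0) (j := i.succ.succ) (Fin.succ_ne_zero _).symm (by ext; simp)

/-- `pairDet` as a linear map in its first row. -/
def pairDetLeft {s : ℕ} (c : Fin s → Fin (s + 2) → ℂ) (y : Fin (s + 2) → ℂ) :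
    (Fin (s + 2) → ℂ) →ₗ[ℂ] ℂ :=
  (detRowAlternating (R := ℂ) (n := Fin (s + 2))).toMultilinearMap.toLinearMap
    (vecCons 0 (vecCons y c)) 0

theorem pairDetLeft_apply {s : ℕ} (c : Fin s → Fin (s + 2) → ℂ) (x y : Fin (s + 2) → ℂ) :
    pairDetLeft c y x = pairDet c x y := by
  have h : Function.update (vecCons 0 (vecCons y c)) 0 x = vecCons x (vecCons y c) := by
    ext1 i
    refine Fin.cases (by simp) (fun i => by simp) i
  change detRowAlternating (Function.update (vecCons 0 (vecCons y c)) 0 x) = _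
  rw [h]
  rfl

/-- The three-term Plücker relation for maximal minors sharing the rows `c`. -/
theorem pairDet_mul_pairDet {s : ℕ} (c : Fin s → Fin (s + 2) → ℂ)
    (a b z w : Fin (s + 2) → ℂ) :
    pairDet c a b * pairDet c z w =
      pairDet c z b * pairDet c a w + pairDet c a z * pairDet c b w := by
  set M : Matrix (Fin (s + 2)) (Fin (s + 2)) ℂ := Matrix.of (vecCons a (vecCons b c)) with hM
  -- Cramer's rule expands `det M • z` in the rows of `M`. Applying `pairDet c · w` kills every row
  -- belonging to `c` and leaves only the terms of `a` and `b`.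
  have h := Matrix.mulVec_cramer Mᵀ z
  rw [det_transpose, mulVec_eq_sum] at h
  simp only [op_smul_eq_smul, transpose_transpose] at h
  have h' := congrArg (pairDetLeft c w) h
  rw [map_sum, Fin.sum_univ_succ, Fin.sum_univ_succ, Finset.sum_eq_zero, map_smul] at h'
  · have e0 : M.updateRow 0 z = Matrix.of (vecCons z (vecCons b c)) := by
      ext i j
      refine Fin.cases ?_ (fun i => ?_) i <;> simp [hM, Matrix.updateRow_apply]
    have e1 : M.updateRow 1 z = Matrix.of (vecCons a (vecCons z c)) := by
      ext i j
      refine Fin.cases ?_ (fun i => Fin.cases ?_ (fun i => ?_) i) i <;>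
        simp [hM, Matrix.updateRow_apply]
      intro h
      exact absurd (Fin.succ_injective _ h) (Fin.succ_ne_zero _)
    simp only [map_smul, cramer_transpose_apply] at h'
    rw [show (Fin.succ 0 : Fin (s + 2)) = 1 from rfl, e0, e1] at h'
    have r0 : M 0 = a := rfl
    have r1 : M 1 = b := rfl
    rw [r0, r1] at h'
    simp only [pairDetLeft_apply, smul_eq_mul, add_zero] at h'
    exact h'.symm
  · intro i _
    have : M i.succ.succ = c i := rfl
    simp only [map_smul, this, pairDetLeft_apply, pairDet_left_mem, smul_zero]

/-- The Vandermonde sign factors into one sign for the pair, one for each point against `c`, and one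
for `c` alone. Only the first depends on how points are paired. No distinctness is needed:
repetitions make both sides zero. -/
theorem plucker_insert_insert {s n : ℕ} (A : Matrix (Fin (s + 2)) (Fin n) ℂ)
    (c : Fin s → Fin n) (x y : Fin n) :
    plucker A (insert x (insert y (Finset.univ.image c))) =
      (((y : ℕ) - (x : ℕ) : ℤ).sign : ℂ) * ((∏ i, ((c i : ℕ) - (x : ℕ) : ℤ)).sign : ℂ) *
        ((∏ i, ((c i : ℕ) - (y : ℕ) : ℤ)).sign : ℂ) *
        ((vandermonde fun i => ((c i : ℕ) : ℤ)).det.sign : ℂ) *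
        pairDet (fun i => A.col (c i)) (A.col x) (A.col y) := by
  have h1 : insert x (insert y (Finset.univ.image c)) =
      Finset.univ.image (vecCons x (vecCons y c) : Fin (s + 2) → Fin n) := by
    ext t
    simp [Fin.exists_fin_succ, eq_comm]
  have h2 : (A.submatrix id (vecCons x (vecCons y c))).det =
      pairDet (fun i => A.col (c i)) (A.col x) (A.col y) := by
    rw [← det_transpose, pairDet]
    congr 1
    ext i j
    refine Fin.cases ?_ (fun i => Fin.cases ?_ (fun i => ?_) i) i <;> simp
  have h3 : (vandermonde fun i =>
      (((vecCons x (vecCons y c) : Fin (s + 2) → Fin n) i : ℕ) : ℤ)).det =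
      ((y : ℕ) - (x : ℕ) : ℤ) * (∏ i, ((c i : ℕ) - (x : ℕ) : ℤ)) *
        (∏ i, ((c i : ℕ) - (y : ℕ) : ℤ)) * (vandermonde fun i => ((c i : ℕ) : ℤ)).det := by
    rw [det_vandermonde, det_vandermonde, Fin.prod_univ_succ, Fin.prod_univ_succ]
    simp only [Fin.prod_Ioi_zero, Fin.prod_Ioi_succ, Fin.prod_univ_succ, cons_val_zero,
      cons_val_succ]
    ring
  rw [h1, plucker_image, h2, h3]
  simp only [Int.sign_mul]
  push_cast
  ring

/-- The three-term Plücker relation for indices in cyclic order. -/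
theorem plucker_three_term {r n : ℕ} (A : Matrix (Fin r) (Fin n) ℂ) (C : Finset (Fin n))
    (hC : C.card + 2 = r) {x₁ x₂ x₃ x₄ : Fin n}
    (h : (x₁ < x₂ ∧ x₂ ≤ x₃ ∧ x₃ < x₄) ∨ (x₄ ≤ x₁ ∧ x₁ < x₂ ∧ x₂ ≤ x₃) ∨
      (x₃ < x₄ ∧ x₄ ≤ x₁ ∧ x₁ < x₂) ∨ (x₂ ≤ x₃ ∧ x₃ < x₄ ∧ x₄ ≤ x₁)) :
    plucker A (insert x₁ (insert x₃ C)) * plucker A (insert x₂ (insert x₄ C)) =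
      plucker A (insert x₁ (insert x₂ C)) * plucker A (insert x₃ (insert x₄ C)) +
        plucker A (insert x₁ (insert x₄ C)) * plucker A (insert x₂ (insert x₃ C)) := by
  subst hC
  have hCc : C = Finset.univ.image (C.orderEmbOfFin rfl) := by
    rw [← Finset.coe_inj]
    simp
  generalize (C.orderEmbOfFin rfl : Fin C.card → Fin n) = c at hCc
  have hB := pairDet_mul_pairDet (fun i => A.col (c i)) (A.col x₁) (A.col x₃) (A.col x₂) (A.col x₄)
  have hp (x y) := plucker_insert_insert A c x y
  rw [← hCc] at hp
  have hself (x) := pairDet_self (fun i => A.col (c i)) (A.col x)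
  have hpos {x y : Fin n} (h : x < y) : ((y : ℕ) - (x : ℕ) : ℤ).sign = 1 :=
    Int.sign_eq_one_of_pos (by have : (x : ℕ) < y := h; omega)
  have hneg {x y : Fin n} (h : y < x) : ((y : ℕ) - (x : ℕ) : ℤ).sign = -1 :=
    Int.sign_eq_neg_one_of_neg (by have : (y : ℕ) < x := h; omega)
  simp only [hp]
  generalize ((vandermonde fun i => ((c i : ℕ) : ℤ)).det.sign : ℂ) = V
  -- Each product in the relation uses every `xᵢ` once, so `K` is common to all three and only the
  -- pair signs remain.
  set K : ℂ := ((∏ i, ((c i : ℕ) - (x₁ : ℕ) : ℤ)).sign : ℂ) *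
    ((∏ i, ((c i : ℕ) - (x₂ : ℕ) : ℤ)).sign : ℂ) * ((∏ i, ((c i : ℕ) - (x₃ : ℕ) : ℤ)).sign : ℂ) *
    ((∏ i, ((c i : ℕ) - (x₄ : ℕ) : ℤ)).sign : ℂ) * V ^ 2
  -- The four cases are the places where the cyclic order can be cut. Moving a point across the cut
  -- flips one pair sign in each product, so the relation changes by a global sign only.
  rcases h with ⟨h1, h2, h3⟩ | ⟨h1, h2, h3⟩ | ⟨h1, h2, h3⟩ | ⟨h1, h2, h3⟩
  · rcases h2.eq_or_lt with rfl | h2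
    · simp only [hself, hpos h1, hpos h3] at hB ⊢
      linear_combination K * hB
    · simp only [hpos h1, hpos h2, hpos h3, hpos (h1.trans h2), hpos (h2.trans h3),
        hpos (h1.trans (h2.trans h3))]
      linear_combination K * hB
  · rcases h1.eq_or_lt with rfl | h1 <;> rcases h3.eq_or_lt with rfl | h3
    · simp only [hself, hpos h2, hneg h2] at hB ⊢
      linear_combination -K * hB
    · simp only [hself, hpos h2, hneg h2, hpos h3, hpos (h2.trans h3), hneg (h2.trans h3)] at hB ⊢
      linear_combination -K * hB
    · simp only [hself, hpos h2, hneg h1, hneg (h1.trans h2)] at hB ⊢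
      linear_combination -K * hB
    · simp only [hpos h2, hpos h3, hpos (h2.trans h3), hneg h1, hneg (h1.trans h2),
        hneg (h1.trans (h2.trans h3))]
      linear_combination -K * hB
  · rcases h2.eq_or_lt with rfl | h2
    · simp only [hself, hpos h1, hneg h1, hpos h3, hneg h3, hneg (h1.trans h3)] at hB ⊢
      linear_combination K * hB
    · simp only [hpos h1, hpos h3, hneg h2, hneg (h1.trans h2), hneg (h2.trans h3),
        hneg (h1.trans (h2.trans h3))]
      linear_combination K * hB
  · rcases h1.eq_or_lt with rfl | h1 <;> rcases h3.eq_or_lt with rfl | h3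
    · simp only [hself, hpos h2, hneg h2] at hB ⊢
      linear_combination -K * hB
    · simp only [hself, hpos h2, hneg h3, hneg (h2.trans h3)] at hB ⊢
      linear_combination -K * hB
    · simp only [hself, hpos h1, hpos h2, hneg h2, hneg (h1.trans h2), hpos (h1.trans h2)] at hB ⊢
      linear_combination -K * hB
    · simp only [hpos h1, hpos h2, hpos (h1.trans h2), hneg h3, hneg (h2.trans h3),
        hneg (h1.trans (h2.trans h3))]
      linear_combination -K * hB

/-! ### Plücker coordinates of sets of integers modulo `n` -/

/-- The Plücker coordinate labelled by the residues modulo `n` of a set of integers. -/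
def cycPlucker {r n : ℕ} (A : Matrix (Fin r) (Fin n) ℂ) (S : Finset ℤ) : ℂ :=
  plucker A (residues n S)

theorem exists_fin_modEq {n : ℕ} (hn : 0 < n) (t : ℤ) :
    ∃ x : Fin n, ((x : ℕ) : ℤ) + 1 ≡ t [ZMOD n] := by
  have hn' : (n : ℤ) ≠ 0 := by omega
  have h1 := Int.emod_nonneg (t - 1) hn'
  have h2 := Int.emod_lt_of_pos (t - 1) (show (0 : ℤ) < n by omega)
  refine ⟨⟨((t - 1) % n).toNat, by omega⟩, ?_⟩
  have : (((t - 1) % n).toNat : ℤ) = (t - 1) % n := Int.toNat_of_nonneg h1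
  change ((((t - 1) % n).toNat : ℕ) : ℤ) + 1 ≡ t [ZMOD n]
  rw [this]
  simpa using (Int.mod_modEq (t - 1) n).add_right 1

theorem residues_insert {n : ℕ} {t : ℤ} {x : Fin n} (h : ((x : ℕ) : ℤ) + 1 ≡ t [ZMOD n])
    (S : Finset ℤ) : residues n (insert t S) = insert x (residues n S) := by
  ext y
  simp only [mem_residues, Finset.mem_insert, exists_eq_or_imp]
  refine or_congr_left ⟨fun h' => ?_, fun h' => h' ▸ h⟩
  have := (h'.trans h.symm).sub_right 1
  exact fin_eq_of_modEq (by simpa using this)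

/-- The three-term Plücker relation for columns indexed by integers modulo `n`. -/
theorem cycPlucker_three_term {r n : ℕ} (A : Matrix (Fin r) (Fin n) ℂ) (C : Finset ℤ)
    (hC : (residues n C).card + 2 = r) {x₁ x₂ x₃ x₄ : ℤ} (h₁₂ : x₁ < x₂) (h₂₃ : x₂ ≤ x₃)
    (h₃₄ : x₃ < x₄) (h₄₁ : x₄ ≤ x₁ + n) :
    cycPlucker A (insert x₁ (insert x₃ C)) * cycPlucker A (insert x₂ (insert x₄ C)) =
      cycPlucker A (insert x₁ (insert x₂ C)) * cycPlucker A (insert x₃ (insert x₄ C)) +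
        cycPlucker A (insert x₁ (insert x₄ C)) * cycPlucker A (insert x₂ (insert x₃ C)) := by
  have hn : 0 < n := by omega
  obtain ⟨y₁, hy₁⟩ := exists_fin_modEq hn x₁
  obtain ⟨y₂, hy₂⟩ := exists_fin_modEq hn x₂
  obtain ⟨y₃, hy₃⟩ := exists_fin_modEq hn x₃
  obtain ⟨y₄, hy₄⟩ := exists_fin_modEq hn x₄
  simp only [cycPlucker, residues_insert hy₁, residues_insert hy₂, residues_insert hy₃,
    residues_insert hy₄]
  refine plucker_three_term A _ hC ?_
  obtain ⟨c₁, hc₁⟩ := hy₁.dvd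
  -- All four integers lie in `[x₁, x₁ + n]`, so reducing them to `[n]` shifts each by the same
  -- multiple of `n` as `x₁` or by one more turn.
  have hwin {x c : ℤ} {y : Fin n} (hx : x₁ ≤ x) (hx' : x ≤ x₁ + n)
      (hc : x - (((y : ℕ) : ℤ) + 1) = n * c) :
      x - (((y : ℕ) : ℤ) + 1) = n * c₁ ∨ x - (((y : ℕ) : ℤ) + 1) = n * c₁ + n := by
    have h1 := y₁.isLt
    have h2 := y.isLt
    have h3 : c₁ - 1 < c := by
      by_contra hcon
      have : (n : ℤ) * c ≤ n * (c₁ - 1) := by gcongr; omega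
      rw [mul_sub] at this
      omega
    have h4 : c < c₁ + 2 := by
      by_contra hcon
      have : (n : ℤ) * (c₁ + 2) ≤ n * c := by gcongr; omega
      rw [mul_add] at this
      omega
    obtain rfl | rfl : c = c₁ ∨ c = c₁ + 1 := by omega
    · exact Or.inl hc
    · rw [mul_add, mul_one] at hc
      exact Or.inr hc
  obtain ⟨c₂, hc₂⟩ := hy₂.dvd
  obtain ⟨c₃, hc₃⟩ := hy₃.dvd
  obtain ⟨c₄, hc₄⟩ := hy₄.dvd
  have e₂ := hwin (by omega) (by omega) hc₂
  have e₃ := hwin (by omega) (by omega) hc₃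
  have e₄ := hwin (by omega) (by omega) hc₄
  have i₁ := y₁.isLt
  have i₂ := y₂.isLt
  have i₃ := y₃.isLt
  have i₄ := y₄.isLt
  simp only [Fin.lt_def, Fin.le_def]
  generalize (n : ℤ) * c₁ = N at *
  clear hwin hc₂ hc₃ hc₄
  omega

theorem card_residues_Ioc_union {n : ℕ} {a b c d : ℤ} (hab : a ≤ b) (hbc : b ≤ c) (hcd : c ≤ d)
    (hda : d ≤ a + n) :
    ((residues n (Finset.Ioc a b ∪ Finset.Ioc c d)).card : ℤ) = (b - a) + (d - c) := by
  rw [card_residues, Finset.card_union_of_disjoint]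
  · simp only [Int.card_Ioc]
    omega
  · rw [Finset.disjoint_left]
    simp only [Finset.mem_Ioc]
    omega
  · simp only [Finset.mem_union, Finset.mem_Ioc]
    omega

theorem cycPlucker_of_card_lt {r n : ℕ} {A : Matrix (Fin r) (Fin n) ℂ} {S : Finset ℤ}
    (h : (residues n S).card < r) : cycPlucker A S = 0 :=
  plucker_of_card_ne h.ne

theorem cycPlucker_of_card_gt {r n : ℕ} {A : Matrix (Fin r) (Fin n) ℂ} {S : Finset ℤ}
    (h : r < (residues n S).card) : cycPlucker A S = 0 :=
  plucker_of_card_ne h.ne'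

/-- The three-term Plücker relation for sets that share the union of two cyclic intervals. -/
theorem cycPlucker_three_term_Ioc {r n : ℕ} (A : Matrix (Fin r) (Fin n) ℂ)
    (α β γ δ x₁ x₂ x₃ x₄ : ℤ) {S₁₃ S₁₂ S₃₄ S₂₄ S₁₄ S₂₃ : Finset ℤ}
    (hC : (α ≤ β ∧ β ≤ γ ∧ γ ≤ δ ∧ δ ≤ α + n) ∧ (β - α) + (δ - γ) + 2 = r)
    (hx : x₁ < x₂ ∧ x₂ ≤ x₃ ∧ x₃ < x₄ ∧ x₄ ≤ x₁ + n)
    (e₁₃ : S₁₃ = {x₁, x₃} ∪ (Finset.Ioc α β ∪ Finset.Ioc γ δ))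
    (e₂₄ : S₂₄ = {x₂, x₄} ∪ (Finset.Ioc α β ∪ Finset.Ioc γ δ))
    (e₁₂ : S₁₂ = {x₁, x₂} ∪ (Finset.Ioc α β ∪ Finset.Ioc γ δ))
    (e₃₄ : S₃₄ = {x₃, x₄} ∪ (Finset.Ioc α β ∪ Finset.Ioc γ δ))
    (e₁₄ : S₁₄ = {x₁, x₄} ∪ (Finset.Ioc α β ∪ Finset.Ioc γ δ))
    (e₂₃ : S₂₃ = {x₂, x₃} ∪ (Finset.Ioc α β ∪ Finset.Ioc γ δ)) :
    cycPlucker A S₁₃ * cycPlucker A S₂₄ =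
      cycPlucker A S₁₂ * cycPlucker A S₃₄ + cycPlucker A S₁₄ * cycPlucker A S₂₃ := by
  have h := card_residues_Ioc_union hC.1.1 hC.1.2.1 hC.1.2.2.1 hC.1.2.2.2
  rw [e₁₃, e₂₄, e₁₂, e₃₄, e₁₄, e₂₃]
  simp only [Finset.insert_union, Finset.singleton_union]
  exact cycPlucker_three_term A _ (by omega) hx.1 hx.2.1 hx.2.2.1 hx.2.2.2

/-- The `p`s are written as the ratios and the Plücker relation produce them, the `q`s as chart
coordinates, which are the ones known not to vanish. -/
theorem div_sub_div_of_three_term₁ {p₁₃ p₂₄ p₁₂ p₃₄ p₁₄ p₂₃ q₁₂ q₂₄ : ℂ}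
    (h : p₁₃ * p₂₄ = p₁₂ * p₃₄ + p₁₄ * p₂₃) (h₁₂ : q₁₂ ≠ 0) (h₂₄ : q₂₄ ≠ 0) (e₁₂ : p₁₂ = q₁₂)
    (e₂₄ : p₂₄ = q₂₄) : p₁₃ / p₁₂ - p₃₄ / p₂₄ = p₂₃ * p₁₄ / (q₁₂ * q₂₄) := by
  subst e₁₂ e₂₄
  field_simp
  linear_combination h

theorem div_sub_div_of_three_term₂ {p₁₃ p₂₄ p₁₂ p₃₄ p₁₄ p₂₃ q₁₃ q₁₄ : ℂ}
    (h : p₁₃ * p₂₄ = p₁₂ * p₃₄ + p₁₄ * p₂₃) (h₁₄ : q₁₄ ≠ 0) (h₁₃ : q₁₃ ≠ 0) (e₁₄ : p₁₄ = q₁₄)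
    (e₁₃ : p₁₃ = q₁₃) : p₂₄ / p₁₄ - p₂₃ / p₁₃ = p₁₂ * p₃₄ / (q₁₄ * q₁₃) := by
  subst e₁₃ e₁₄
  field_simp
  linear_combination h

theorem div_sub_div_of_three_term₃ {p₁₃ p₂₄ p₁₂ p₃₄ p₁₄ p₂₃ q₁₃ q₂₃ : ℂ}
    (h : p₁₃ * p₂₄ = p₁₂ * p₃₄ + p₁₄ * p₂₃) (h₁₃ : q₁₃ ≠ 0) (h₂₃ : q₂₃ ≠ 0) (e₁₃ : p₁₃ = q₁₃)
    (e₂₃ : p₂₃ = q₂₃) : p₂₄ / p₂₃ - p₁₄ / p₁₃ = p₁₂ * p₃₄ / (q₁₃ * q₂₃) := by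
  subst e₁₃ e₂₃
  field_simp
  linear_combination h

/-- Used at the edge of the grid, where two chart labels coincide and their coordinates cancel. -/
theorem div_eq_mul_div_mul {p q s t u v : ℂ} (hu : u ≠ 0) (hv : v ≠ 0) (e₁ : p = s) (e₂ : q = u)
    (e₃ : t = v) : p / q = s * t / (u * v) := by
  subst e₁ e₂ e₃
  field_simp

theorem div_eq_mul_div_mul' {p q s t u v : ℂ} (hu : u ≠ 0) (hv : v ≠ 0) (e₁ : p = s) (e₂ : q = u)
    (e₃ : t = v) : p / q = t * s / (v * u) := by
  rw [mul_comm t, mul_comm v, div_eq_mul_div_mul hu hv e₁ e₂ e₃]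

/-! ### Interpolating ratios along a diagonal -/

/-- The values `y a b` are the Plücker coordinates of `A` labelled by the rotated and reflected
dual checkboard labels, and none of them vanishes. -/
structure IsCheckboardChart {r n : ℕ} (k : ℕ) (m : ℤ) (A : Matrix (Fin r) (Fin n) ℂ)
    (y : ℤ → ℤ → ℂ) : Prop where
  add_eq : r + k = n
  eq : ∀ a b c : ℤ, InGrid k n a b → (a + b + 1) / 2 = c →
    y a b = cycPlucker A (Finset.Ioc (c + m) (c + m + (n - k - a)) ∪
      Finset.Ioc (n - a - b + (c + m)) (n - b + (c + m)))
  ne_zero : ∀ a b : ℤ, InGrid k n a b → y a b ≠ 0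

/-- The ratio of Plücker coordinates that interpolates along an even diagonal `a - b = 2 * e`. -/
noncomputable def evenRatio {r n : ℕ} (m : ℤ) (A : Matrix (Fin r) (Fin n) ℂ) (e U u : ℤ) : ℂ :=
  cycPlucker A (insert (r - e + 1 + m)
      (Finset.Ioc (U + m) (r - e - 1 + m) ∪ Finset.Ioc (n - u + m) (n + e + U - u + m))) /
    cycPlucker A (Finset.Ioc (U + m) (r - e + m) ∪ Finset.Ioc (n - u + m) (n + e + U - u + m))

/-- The ratio of Plücker coordinates that interpolates along an odd diagonal
`a - b = 2 * g - 1`. -/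
noncomputable def oddRatio {r n : ℕ} (m : ℤ) (A : Matrix (Fin r) (Fin n) ℂ) (g V w : ℤ) : ℂ :=
  cycPlucker A (insert (n + g + 1 + m)
      (Finset.Ioc (V + m) (r - g + V - w + m) ∪ Finset.Ioc (n - w + m) (n + g - 1 + m))) /
    cycPlucker A (Finset.Ioc (V + m) (r - g + V - w + m) ∪ Finset.Ioc (n - w + m) (n + g + m))

section Steps

variable {r n k : ℕ} {m : ℤ} {A : Matrix (Fin r) (Fin n) ℂ} {y : ℤ → ℤ → ℂ}

/-- This is the edge `a = r`: the first interval of the label is already empty, so the inserted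
point makes the numerator's label too large, with `r + 1` elements. -/
theorem evenRatio_eq_zero₁ (hn : r + k = n) {e : ℤ} (h₁ : 1 ≤ r)
    (h₂ : 2 * e + 1 ≤ r) (h₃ : r - 2 * e ≤ k) : evenRatio m A e (r - e) (r - e - 1) = 0 := by
  unfold evenRatio
  rw [cycPlucker_of_card_gt, zero_div]
  have h := card_residues_Ioc_union (n := n) (a := r - e + m) (b := r - e + 1 + m)
    (c := n - (r - e - 1) + m) (d := n + e + 1 + m) (by omega) (by omega) (by omega) (by omega)
  rw [show insert (r - e + 1 + m) (Finset.Ioc (r - e + m) (r - e - 1 + m) ∪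
      Finset.Ioc (n - (r - e - 1) + m) (n + e + (r - e) - (r - e - 1) + m)) =
      Finset.Ioc (r - e + m) (r - e + 1 + m) ∪
        Finset.Ioc (n - (r - e - 1) + m) (n + e + 1 + m) by
    ext x
    simp only [Finset.mem_insert, Finset.mem_union, Finset.mem_Ioc]
    omega]
  omega

theorem oddRatio_eq_zero₁ (hn : r + k = n) {g : ℤ} (h₁ : 2 * g ≤ 0) (h₂ : 1 - 2 * g ≤ k) :
    oddRatio m A g (1 - g) (1 - g - 1) = 0 := by
  unfold oddRatio
  rw [cycPlucker_of_card_gt, zero_div]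
  have h := card_residues_Ioc_union (n := n) (a := 1 - g + m) (b := r - g + 1 + m)
    (c := n + g + m) (d := n + g + 1 + m) (by omega) (by omega) (by omega) (by omega)
  rw [show insert (n + g + 1 + m) (Finset.Ioc (1 - g + m) (r - g + (1 - g) - (1 - g - 1) + m) ∪
      Finset.Ioc (n - (1 - g - 1) + m) (n + g - 1 + m)) =
      Finset.Ioc (1 - g + m) (r - g + 1 + m) ∪ Finset.Ioc (n + g + m) (n + g + 1 + m) by
    ext x
    simp only [Finset.mem_insert, Finset.mem_union, Finset.mem_Ioc]
    omega]
  omega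

/-- The denominator of `evenRatio m A e U u` is `y (U + e) (u - e)`, so raising `U` and `u`
alternately walks up the staircase around the diagonal. Here `U` is raised. -/
theorem evenRatio_sub_evenRatio₁ (h : IsCheckboardChart k m A y) {e u : ℤ} (ha : 0 ≤ u + e)
    (ha' : u + e + 1 ≤ r) (hb : 1 ≤ u - e) (hb' : u - e + 1 ≤ k) :
    evenRatio m A e u u - evenRatio m A e (u + 1) u =
      y (u + e) (u - e + 1) * y (u + e + 1) (u - e - 1) /
        (y (u + e) (u - e) * y (u + e + 1) (u - e)) := by
  have hn := h.add_eq
  have g₀ : InGrid k n (u + e) (u - e + 1) := by unfold InGrid; omega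
  have g₁ : InGrid k n (u + e + 1) (u - e - 1) := by unfold InGrid; omega
  have g₂ : InGrid k n (u + e) (u - e) := by unfold InGrid; omega
  have g₃ : InGrid k n (u + e + 1) (u - e) := by unfold InGrid; omega
  have n₂ := h.ne_zero _ _ g₂
  have n₃ := h.ne_zero _ _ g₃
  rw [h.eq _ _ (u) g₂ (by omega)] at n₂ ⊢
  rw [h.eq _ _ (u + 1) g₃ (by omega)] at n₃ ⊢
  rw [h.eq _ _ (u + 1) g₀ (by omega), h.eq _ _ (u) g₁ (by omega)]
  unfold evenRatio
  obtain hlt | heq := lt_or_eq_of_le ha'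
  · refine div_sub_div_of_three_term₁
      (cycPlucker_three_term_Ioc A (u + 1 + m) (r - e - 1 + m) (n - u + m) (n + e + m)
        (u + 1 + m) (r - e + m) (r - e + 1 + m) (n + e + 1 + m)
        (by omega) (by omega) ?_ ?_ ?_ ?_ ?_ ?_) n₂ n₃ (congrArg _ ?_) (congrArg _ ?_)
    all_goals
      ext x
      simp only [Finset.mem_insert, Finset.mem_singleton, Finset.mem_union, Finset.mem_Ioc]
      omega
  -- At `a + 1 = r` the common part of the labels would have an interval of length `-1`. Instead,
  -- the subtracted ratio vanishes and two frozen coordinates coincide.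
  · obtain rfl : u = r - e - 1 := by omega
    have h0 := evenRatio_eq_zero₁ (m := m) (A := A) hn (e := e) (by omega) (by omega) (by omega)
    unfold evenRatio at h0
    rw [show (r - e - 1 + 1 : ℤ) = r - e by ring] at *
    rw [h0, sub_zero]
    refine div_eq_mul_div_mul n₂ n₃ (congrArg _ ?_) (congrArg _ ?_) (congrArg _ ?_)
    all_goals
      ext x
      simp only [Finset.mem_insert, Finset.mem_union, Finset.mem_Ioc]
      omega

theorem evenRatio_sub_evenRatio₂ (h : IsCheckboardChart k m A y) {e u : ℤ} (ha : 1 ≤ u + e)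
    (ha' : u + e + 1 ≤ r) (hb : 1 ≤ u - e) (hb' : u - e ≤ k) :
    evenRatio m A e u (u - 1) - evenRatio m A e u u =
      y (u + e - 1) (u - e) * y (u + e + 1) (u - e - 1) /
        (y (u + e) (u - e - 1) * y (u + e) (u - e)) := by
  have hn := h.add_eq
  have g₀ : InGrid k n (u + e - 1) (u - e) := by unfold InGrid; omega
  have g₁ : InGrid k n (u + e + 1) (u - e - 1) := by unfold InGrid; omega
  have g₂ : InGrid k n (u + e) (u - e - 1) := by unfold InGrid; omega
  have g₃ : InGrid k n (u + e) (u - e) := by unfold InGrid; omega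
  have n₂ := h.ne_zero _ _ g₂
  have n₃ := h.ne_zero _ _ g₃
  rw [h.eq _ _ (u) g₂ (by omega)] at n₂ ⊢
  rw [h.eq _ _ (u) g₃ (by omega)] at n₃ ⊢
  rw [h.eq _ _ (u) g₀ (by omega), h.eq _ _ (u) g₁ (by omega)]
  unfold evenRatio
  -- The middle points coincide when `u - e = k`; this is why the relation allows `x₂ = x₃`.
  refine div_sub_div_of_three_term₂
    (cycPlucker_three_term_Ioc A (u + m) (r - e - 1 + m) (n + 1 - u + m) (n + e + m)
      (r - e + m) (r - e + 1 + m) (n - u + 1 + m) (n + e + 1 + m)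
      (by omega) (by omega) ?_ ?_ ?_ ?_ ?_ ?_) n₂ n₃ (congrArg _ ?_) (congrArg _ ?_)
  all_goals
    ext x
    simp only [Finset.mem_insert, Finset.mem_singleton, Finset.mem_union, Finset.mem_Ioc]
    omega

/-- The denominator of `oddRatio m A g V w` is `y (w + g) (V - g)`. Along the diagonal `V` and `w`
are raised alternately; here it is `w`. -/
theorem oddRatio_sub_oddRatio₁ (h : IsCheckboardChart k m A y) {g v : ℤ} (ha : 0 ≤ v + g - 1)
    (ha' : v + g ≤ r) (hb : 1 ≤ v - g) (hb' : v - g + 1 ≤ k) :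
    oddRatio m A g v v - oddRatio m A g v (v - 1) =
      y (v + g - 1) (v - g + 1) * y (v + g - 1 + 1) (v - g - 1) /
        (y (v + g - 1) (v - g) * y (v + g - 1 + 1) (v - g)) := by
  have hn := h.add_eq
  have g₀ : InGrid k n (v + g - 1) (v - g + 1) := by unfold InGrid; omega
  have g₁ : InGrid k n (v + g - 1 + 1) (v - g - 1) := by unfold InGrid; omega
  have g₂ : InGrid k n (v + g - 1) (v - g) := by unfold InGrid; omega
  have g₃ : InGrid k n (v + g - 1 + 1) (v - g) := by unfold InGrid; omega
  have n₂ := h.ne_zero _ _ g₂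
  have n₃ := h.ne_zero _ _ g₃
  rw [h.eq _ _ (v) g₂ (by omega)] at n₂ ⊢
  rw [h.eq _ _ (v) g₃ (by omega)] at n₃ ⊢
  rw [h.eq _ _ (v) g₀ (by omega), h.eq _ _ (v) g₁ (by omega)]
  unfold oddRatio
  obtain hlt | heq := lt_or_eq_of_le ha
  · refine div_sub_div_of_three_term₃
      (cycPlucker_three_term_Ioc A (v + m) (r - g + m) (n + 1 - v + m) (n + g - 1 + m)
        (r - g + 1 + m) (n + 1 - v + m) (n + g + m) (n + g + 1 + m)
        (by omega) (by omega) ?_ ?_ ?_ ?_ ?_ ?_) n₂ n₃ (congrArg _ ?_) (congrArg _ ?_)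
    all_goals
      ext x
      simp only [Finset.mem_insert, Finset.mem_singleton, Finset.mem_union, Finset.mem_Ioc]
      omega
  · obtain rfl : v = 1 - g := by omega
    have h0 := oddRatio_eq_zero₁ (m := m) (A := A) hn (g := g) (by omega) (by omega)
    unfold oddRatio at h0
    rw [h0, sub_zero]
    refine div_eq_mul_div_mul' n₃ n₂ (congrArg _ ?_) (congrArg _ ?_) (congrArg _ ?_)
    all_goals
      ext x
      simp only [Finset.mem_insert, Finset.mem_union, Finset.mem_Ioc]
      omega

theorem oddRatio_sub_oddRatio₂ (h : IsCheckboardChart k m A y) {g v : ℤ} (ha : 1 ≤ v + g - 1)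
    (ha' : v + g ≤ r) (hb : 1 ≤ v - g) (hb' : v - g ≤ k) :
    oddRatio m A g v (v - 1) - oddRatio m A g (v - 1) (v - 1) =
      y (v + g - 1 - 1) (v - g) * y (v + g - 1 + 1) (v - g - 1) /
        (y (v + g - 1) (v - g - 1) * y (v + g - 1) (v - g)) := by
  have hn := h.add_eq
  have g₀ : InGrid k n (v + g - 1 - 1) (v - g) := by unfold InGrid; omega
  have g₁ : InGrid k n (v + g - 1 + 1) (v - g - 1) := by unfold InGrid; omega
  have g₂ : InGrid k n (v + g - 1) (v - g - 1) := by unfold InGrid; omega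
  have g₃ : InGrid k n (v + g - 1) (v - g) := by unfold InGrid; omega
  have n₂ := h.ne_zero _ _ g₂
  have n₃ := h.ne_zero _ _ g₃
  rw [h.eq _ _ (v - 1) g₂ (by omega)] at n₂ ⊢
  rw [h.eq _ _ (v) g₃ (by omega)] at n₃ ⊢
  rw [h.eq _ _ (v - 1) g₀ (by omega), h.eq _ _ (v) g₁ (by omega)]
  unfold oddRatio
  -- When `v - g = 1` the outer points agree modulo `n`; this is why the relation allows `x₄ = x₁ +
  -- n`.
  refine div_sub_div_of_three_term₃
    (cycPlucker_three_term_Ioc A (v + m) (r - g + m) (n + 1 - v + m) (n + g - 1 + m)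
      (v + m) (r - g + 1 + m) (n + g + m) (n + g + 1 + m)
      (by omega) (by omega) ?_ ?_ ?_ ?_ ?_ ?_) n₂ n₃ (congrArg _ ?_) (congrArg _ ?_)
  all_goals
    ext x
    simp only [Finset.mem_insert, Finset.mem_singleton, Finset.mem_union, Finset.mem_Ioc]
    omega

theorem residues_congr {S T : Finset ℤ} (h₁ : ∀ s ∈ S, s ∈ T ∨ s + n ∈ T ∨ s - n ∈ T)
    (h₂ : ∀ s ∈ T, s ∈ S ∨ s + n ∈ S ∨ s - n ∈ S) : residues n S = residues n T := by
  have key {S T : Finset ℤ} (h : ∀ s ∈ S, s ∈ T ∨ s + n ∈ T ∨ s - n ∈ T) {x : Fin n}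
      (hx : x ∈ residues n S) : x ∈ residues n T := by
    obtain ⟨t, ht, hxt⟩ := mem_residues.1 hx
    rw [mem_residues]
    rcases h t ht with h | h | h
    · exact ⟨_, h, hxt⟩
    · exact ⟨_, h, hxt.trans (by simp)⟩
    · exact ⟨_, h, hxt.trans (by simp [Int.modEq_iff_dvd])⟩
  ext x
  exact ⟨key h₁, key h₂⟩

/-- This is the edge `b = k`: the inserted point already lies in the second interval, so the
numerator's label has only `r - 1` elements. -/
theorem evenRatio_eq_zero₂ (hn : r + k = n) {e : ℤ} (h₁ : 1 ≤ k + 2 * e) (h₂ : k + 2 * e + 1 ≤ r) :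
    evenRatio m A e (k + e) (k + e) = 0 := by
  unfold evenRatio
  rw [cycPlucker_of_card_lt, zero_div]
  have h := card_residues_Ioc_union (n := n) (a := k + e + m) (b := r - e - 1 + m)
    (c := r - e + m) (d := n + e + m) (by omega) (by omega) (by omega) (by omega)
  rw [show insert (r - e + 1 + m) (Finset.Ioc (k + e + m) (r - e - 1 + m) ∪
      Finset.Ioc (n - (k + e) + m) (n + e + (k + e) - (k + e) + m)) =
      Finset.Ioc (k + e + m) (r - e - 1 + m) ∪ Finset.Ioc (r - e + m) (n + e + m) by
    ext x
    simp only [Finset.mem_insert, Finset.mem_union, Finset.mem_Ioc]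
    omega]
  omega

theorem oddRatio_eq_zero₂ (hn : r + k = n) {g : ℤ} (h₁ : 1 ≤ g) (h₂ : 2 * g + 1 ≤ r) :
    oddRatio m A g g g = 0 := by
  unfold oddRatio
  rw [cycPlucker_of_card_lt, zero_div]
  have h := card_residues_Ioc_union (n := n) (a := g + m) (b := r - g + m)
    (c := n - g + m) (d := n + g - 1 + m) (by omega) (by omega) (by omega) (by omega)
  rw [residues_congr (T := Finset.Ioc (g + m) (r - g + m) ∪
      Finset.Ioc (n - g + m) (n + g - 1 + m))]
  · omega
  all_goals
    simp only [Finset.mem_insert, Finset.mem_union, Finset.mem_Ioc]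
    omega

/-- The summand `p_{J_i⁺} / p_{J_i}` of the superpotential. -/
noncomputable def frozenRatio {r n : ℕ} (k : ℕ) (A : Matrix (Fin r) (Fin n) ℂ) (i : ℤ) : ℂ :=
  plucker A (frozenLabelPlus n k i) / plucker A (frozenLabel n k i)

theorem cycPlucker_div_cycPlucker_eq_frozenRatio (i : ℤ) {S T : Finset ℤ}
    (hS₁ : ∀ s ∈ S, s ∈ Finset.Icc (i + 1) (i + n - k - 1) ∪ {i + n - k + 1} ∨
      s + n ∈ Finset.Icc (i + 1) (i + n - k - 1) ∪ {i + n - k + 1} ∨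
      s - n ∈ Finset.Icc (i + 1) (i + n - k - 1) ∪ {i + n - k + 1})
    (hS₂ : ∀ s ∈ Finset.Icc (i + 1) (i + n - k - 1) ∪ {i + n - k + 1},
      s ∈ S ∨ s + n ∈ S ∨ s - n ∈ S)
    (hT₁ : ∀ s ∈ T, s ∈ Finset.Icc (i + 1) (i + n - k) ∨
      s + n ∈ Finset.Icc (i + 1) (i + n - k) ∨ s - n ∈ Finset.Icc (i + 1) (i + n - k))
    (hT₂ : ∀ s ∈ Finset.Icc (i + 1) (i + n - k), s ∈ T ∨ s + n ∈ T ∨ s - n ∈ T) :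
    cycPlucker A S / cycPlucker A T = frozenRatio k A i := by
  unfold cycPlucker frozenRatio frozenLabelPlus frozenLabel
  rw [residues_congr hS₁ hS₂, residues_congr hT₁ hT₂, residues_union]

/-- The diagonal starts at the edge `a = 0` here and at `b = 0` in the next lemma; on both edges the
denominator's label is one cyclic interval modulo `n`. -/
theorem evenRatio_eq_frozenRatio₁ (hn : r + k = n) {e : ℤ} (h₁ : 2 * e ≤ 0) (h₂ : 1 - 2 * e ≤ k) :
    evenRatio m A e (-e) (-e) = frozenRatio k A (m - e) := by
  unfold evenRatio
  apply cycPlucker_div_cycPlucker_eq_frozenRatio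
  all_goals
    simp only [Finset.mem_insert, Finset.mem_union, Finset.mem_Ioc, Finset.mem_Icc,
      Finset.mem_singleton]
    omega

theorem evenRatio_eq_frozenRatio₂ (hn : r + k = n) {e : ℤ} (h₁ : 0 ≤ e) (h₂ : 2 * e + 2 ≤ r) :
    evenRatio m A e (e + 1) e = frozenRatio k A (m - e) := by
  unfold evenRatio
  apply cycPlucker_div_cycPlucker_eq_frozenRatio
  all_goals
    simp only [Finset.mem_insert, Finset.mem_union, Finset.mem_Ioc, Finset.mem_Icc,
      Finset.mem_singleton]
    omega

theorem oddRatio_eq_frozenRatio₁ (hn : r + k = n) {g : ℤ} (h₁ : r + 1 ≤ k + 2 * g) (h₂ : 2 * g + 1 ≤ r) :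
    oddRatio m A g (r - g) (r - g) = frozenRatio k A (m + k + g) := by
  unfold oddRatio
  apply cycPlucker_div_cycPlucker_eq_frozenRatio
  all_goals
    simp only [Finset.mem_insert, Finset.mem_union, Finset.mem_Ioc, Finset.mem_Icc,
      Finset.mem_singleton]
    omega

theorem oddRatio_eq_frozenRatio₂ (hn : r + k = n) {g : ℤ} (h₁ : 2 ≤ k + 2 * g) (h₂ : k + 2 * g ≤ r) :
    oddRatio m A g (k + g) (k + g - 1) = frozenRatio k A (m + k + g) := by
  unfold oddRatio
  apply cycPlucker_div_cycPlucker_eq_frozenRatio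
  all_goals
    simp only [Finset.mem_insert, Finset.mem_union, Finset.mem_Ioc, Finset.mem_Icc,
      Finset.mem_singleton]
    omega

theorem frozenRatio_add_mul (i c : ℤ) : frozenRatio k A (i + n * c) = frozenRatio k A i := by
  have h (a b : ℤ) : residues n (Finset.Icc (a + n * c) (b + n * c)) =
      residues n (Finset.Icc a b) := by
    rw [← residues_image_add_mul n (Finset.Icc a b) c, Finset.image_add_right_Icc]
  have h' (a : ℤ) : residues n {a + n * c} = residues n {a} := by
    rw [← residues_image_add_mul n {a} c, Finset.image_singleton]
  unfold frozenRatio frozenLabelPlus frozenLabel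
  rw [← h (i + 1) (i + n - k), ← h (i + 1) (i + n - k - 1), ← h' (i + n - k + 1)]
  congr 4 <;> ring_nf

end Steps

/-! ### Telescoping along the diagonals -/

theorem sum_Icc_sub_succ (F : ℤ → ℂ) {a b : ℤ} (hab : a ≤ b + 1) :
    ∑ t ∈ Finset.Icc a b, (F t - F (t + 1)) = F a - F (b + 1) := by
  obtain ⟨c, rfl⟩ : ∃ c, b = c - 1 := ⟨b + 1, by ring⟩
  rw [sub_add_cancel] at *
  induction c, hab using Int.leInduction with
  | base => simp
  | succ c hc ih =>
    rw [show Finset.Icc a (c + 1 - 1) = insert c (Finset.Icc a (c - 1)) by ext; simp; omega,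
      Finset.sum_insert (by simp), ih]
    ring

theorem mem_grid {k n : ℕ} {p : ℤ × ℤ} : p ∈ grid k n ↔ InGrid k n p.1 p.2 := by
  simp only [grid, InGrid, Finset.mem_product, Finset.mem_Icc, and_assoc]

/-- The two sums are interleaved by `t = a + b` and `t = a + b - 1`: the parity of `t - d` tells
them apart, and the grid conditions become one interval of `t`. -/
theorem diagSum₁_add_diagSum₂ (k n : ℕ) (y : ℤ → ℤ → ℂ) (d : ℤ) :
    diagSum₁ k n y d + diagSum₂ k n y d =
      ∑ t ∈ Finset.Icc (max (-d) (d + 1)) (min (2 * (n - k) - 2 - d) (2 * k + d - 1)),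
        if (t - d) % 2 = 0 then
          (y ((t + d) / 2) ((t - d) / 2 + 1) * y ((t + d) / 2 + 1) ((t - d) / 2 - 1)) /
            (y ((t + d) / 2) ((t - d) / 2) * y ((t + d) / 2 + 1) ((t - d) / 2))
        else
          (y ((t + 1 + d) / 2 - 1) ((t + 1 - d) / 2) *
              y ((t + 1 + d) / 2 + 1) ((t + 1 - d) / 2 - 1)) /
            (y ((t + 1 + d) / 2) ((t + 1 - d) / 2 - 1) * y ((t + 1 + d) / 2) ((t + 1 - d) / 2)) := by
  rw [Finset.sum_ite]
  congr 1
  · refine Finset.sum_nbij' (fun p => p.1 + p.2) (fun t => ((t + d) / 2, (t - d) / 2)) ?_ ?_ ?_ ?_ ?_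
    · rintro ⟨a, b⟩
      simp only [Finset.mem_filter, mem_grid, Finset.mem_Icc, max_le_iff, le_min_iff]
      simp only [InGrid]
      omega
    · intro t
      simp only [Finset.mem_filter, mem_grid, Finset.mem_Icc, max_le_iff, le_min_iff]
      simp only [InGrid]
      omega
    · rintro ⟨a, b⟩
      simp only [Finset.mem_filter, Prod.mk.injEq]
      omega
    · intro t
      simp only [Finset.mem_filter, Finset.mem_Icc, max_le_iff, le_min_iff]
      omega
    · rintro ⟨a, b⟩ h
      have hd : a - b = d := (Finset.mem_filter.1 h).2.1
      rw [show (a + b + d) / 2 = a by omega, show (a + b - d) / 2 = b by omega]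
  · refine Finset.sum_nbij' (fun p => p.1 + p.2 - 1)
      (fun t => ((t + 1 + d) / 2, (t + 1 - d) / 2)) ?_ ?_ ?_ ?_ ?_
    · rintro ⟨a, b⟩
      simp only [Finset.mem_filter, mem_grid, Finset.mem_Icc, max_le_iff, le_min_iff]
      simp only [InGrid]
      omega
    · intro t
      simp only [Finset.mem_filter, mem_grid, Finset.mem_Icc, max_le_iff, le_min_iff]
      simp only [InGrid]
      omega
    · rintro ⟨a, b⟩
      simp only [Finset.mem_filter, Prod.mk.injEq]
      omega
    · intro t
      simp only [Finset.mem_filter, Finset.mem_Icc, max_le_iff, le_min_iff]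
      omega
    · rintro ⟨a, b⟩ h
      have hd : a - b = d := (Finset.mem_filter.1 h).2.1
      rw [show (a + b - 1 + 1 + d) / 2 = a by omega, show (a + b - 1 + 1 - d) / 2 = b by omega]

section Diagonals

variable {r n k : ℕ} {m : ℤ} {A : Matrix (Fin r) (Fin n) ℂ} {y : ℤ → ℤ → ℂ}

theorem diagSum_even (h : IsCheckboardChart k m A y) (hk : 1 ≤ k) (hr : 1 ≤ r) {e : ℤ}
    (h₁ : 1 - k ≤ 2 * e)
    (h₂ : 2 * e ≤ r - 2) :
    diagSum₁ k n y (2 * e) + diagSum₂ k n y (2 * e) = frozenRatio k A (m - e) := by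
  have hn := h.add_eq
  -- Passing from `t` to `t + 1` raises `U = (t + 1) / 2` and `u = t / 2` alternately.
  set F : ℤ → ℂ := fun t => evenRatio m A e ((t + 1) / 2) (t / 2) with hF
  rw [diagSum₁_add_diagSum₂, Finset.sum_congr rfl (g := fun t => F t - F (t + 1)),
    sum_Icc_sub_succ F (by omega)]
  · have hstart : F (max (-(2 * e)) (2 * e + 1)) = frozenRatio k A (m - e) := by
      rcases le_total (2 * e + 1) (-(2 * e)) with hle | hle
      · rw [max_eq_left hle, ← evenRatio_eq_frozenRatio₁ hn (by omega) (by omega)]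
        simp only [hF]
        congr 1 <;> omega
      · rw [max_eq_right hle, ← evenRatio_eq_frozenRatio₂ hn (by omega) (by omega)]
        simp only [hF]
        congr 1 <;> omega
    have hend : F (min (2 * (n - k) - 2 - 2 * e) (2 * k + 2 * e - 1) + 1) = 0 := by
      rcases le_total (2 * (n - k) - 2 - 2 * e : ℤ) (2 * k + 2 * e - 1) with hle | hle
      · rw [min_eq_left hle,
          ← evenRatio_eq_zero₁ (m := m) (A := A) hn (e := e) (by omega) (by omega) (by omega)]
        simp only [hF]
        congr 1 <;> omega
      · rw [min_eq_right hle,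
          ← evenRatio_eq_zero₂ (m := m) (A := A) hn (e := e) (by omega) (by omega)]
        simp only [hF]
        congr 1 <;> omega
    rw [hstart, hend, sub_zero]
  · intro t ht
    simp only [Finset.mem_Icc, max_le_iff, le_min_iff] at ht
    simp only [hF]
    split_ifs with hp
    · obtain ⟨u, rfl⟩ : ∃ u, t = 2 * u := ⟨t / 2, by omega⟩
      rw [show (2 * u + 1) / 2 = u by omega, show (2 * u) / 2 = u by omega,
        show (2 * u + 1 + 1) / 2 = u + 1 by omega, show (2 * u + 2 * e) / 2 = u + e by omega,
        show (2 * u - 2 * e) / 2 = u - e by omega,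
        evenRatio_sub_evenRatio₁ h (by omega) (by omega) (by omega) (by omega)]
    · obtain ⟨u, rfl⟩ : ∃ u, t = 2 * u - 1 := ⟨(t + 1) / 2, by omega⟩
      rw [sub_add_cancel, show (2 * u + 1) / 2 = u by omega, show (2 * u) / 2 = u by omega,
        show (2 * u - 1) / 2 = u - 1 by omega, show (2 * u + 2 * e) / 2 = u + e by omega,
        show (2 * u - 2 * e) / 2 = u - e by omega,
        evenRatio_sub_evenRatio₂ h (by omega) (by omega) (by omega) (by omega)]

theorem diagSum_odd (h : IsCheckboardChart k m A y) (hk : 1 ≤ k) (hr : 1 ≤ r) {g : ℤ}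
    (h₁ : 1 - k ≤ 2 * g - 1)
    (h₂ : 2 * g - 1 ≤ r - 2) :
    diagSum₁ k n y (2 * g - 1) + diagSum₂ k n y (2 * g - 1) = frozenRatio k A (m + k + g) := by
  have hn := h.add_eq
  -- The sign is reversed because on an odd diagonal the ratio begins at zero and ends at the frozen
  -- ratio.
  set F : ℤ → ℂ := fun t => -oddRatio m A g ((t + 1) / 2) (t / 2) with hF
  rw [diagSum₁_add_diagSum₂, Finset.sum_congr rfl (g := fun t => F t - F (t + 1)),
    sum_Icc_sub_succ F (by omega)]
  · have hstart : F (max (-(2 * g - 1)) (2 * g - 1 + 1)) = 0 := by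
      rw [← neg_zero]
      rcases le_total (2 * g - 1 + 1) (-(2 * g - 1)) with hle | hle
      · rw [max_eq_left hle,
          ← oddRatio_eq_zero₁ (m := m) (A := A) hn (g := g) (by omega) (by omega)]
        simp only [hF]
        congr 2 <;> omega
      · rw [max_eq_right hle,
          ← oddRatio_eq_zero₂ (m := m) (A := A) hn (g := g) (by omega) (by omega)]
        simp only [hF]
        congr 2 <;> omega
    have hend : F (min (2 * (n - k) - 2 - (2 * g - 1)) (2 * k + (2 * g - 1) - 1) + 1) =
        -frozenRatio k A (m + k + g) := by
      rcases le_total (2 * (n - k) - 2 - (2 * g - 1) : ℤ) (2 * k + (2 * g - 1) - 1) with hle | hle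
      · rw [min_eq_left hle, ← oddRatio_eq_frozenRatio₁ hn (by omega) (by omega)]
        simp only [hF]
        congr 2 <;> omega
      · rw [min_eq_right hle, ← oddRatio_eq_frozenRatio₂ hn (by omega) (by omega)]
        simp only [hF]
        congr 2 <;> omega
    rw [hstart, hend, zero_sub, neg_neg]
  · intro t ht
    simp only [Finset.mem_Icc, max_le_iff, le_min_iff] at ht
    simp only [hF]
    split_ifs with hp
    · obtain ⟨v, rfl⟩ : ∃ v, t = 2 * v - 1 := ⟨(t + 1) / 2, by omega⟩
      rw [sub_add_cancel, show (2 * v + 1) / 2 = v by omega, show (2 * v) / 2 = v by omega,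
        show (2 * v - 1) / 2 = v - 1 by omega,
        show (2 * v - 1 + (2 * g - 1)) / 2 = v + g - 1 by omega,
        show (2 * v - 1 - (2 * g - 1)) / 2 = v - g by omega,
        ← oddRatio_sub_oddRatio₁ h (by omega) (by omega) (by omega) (by omega)]
      ring
    · obtain ⟨v, rfl⟩ : ∃ v, t = 2 * v - 2 := ⟨(t + 2) / 2, by omega⟩
      rw [show (2 * v - 2 + 1) / 2 = v - 1 by omega, show (2 * v - 2) / 2 = v - 1 by omega,
        show (2 * v - 2 + 1 + 1) / 2 = v by omega,
        show (2 * v - 2 + 1 + (2 * g - 1)) / 2 = v + g - 1 by omega,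
        show (2 * v - 2 + 1 - (2 * g - 1)) / 2 = v - g by omega,
        ← oddRatio_sub_oddRatio₂ h (by omega) (by omega) (by omega) (by omega)]
      ring

end Diagonals

/-! ### Powers of `q` and the matching of summands -/

theorem cycDelta_intCast (n : ℕ) (m z : ℤ) [Decidable (m ≡ z [ZMOD n])] :
    cycDelta n m z = if m ≡ z [ZMOD n] then 1 else 0 := by
  unfold cycDelta
  congr 1
  simp

theorem eps_even (k n : ℕ) (m e : ℤ) : eps k n m (2 * e : ℤ) = cycDelta n m (e + k : ℤ) := by
  have h1 : (((2 * e : ℤ) : ℚ) / 2 + k) = ((e + k : ℤ) : ℚ) := by push_cast; ring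
  have h2 : cycDelta n m (-(((2 * e : ℤ) : ℚ) + 1) / 2) = 0 := by
    unfold cycDelta
    rw [if_neg]
    rintro ⟨z, hz, -⟩
    have : ((-(2 * e + 1) : ℤ) : ℚ) = (2 * z : ℤ) := by
      push_cast at hz ⊢
      linarith
    have := Int.cast_injective this
    omega
  rw [eps, h1, h2, add_zero]

theorem eps_odd (k n : ℕ) (m g : ℤ) : eps k n m (2 * g - 1 : ℤ) = cycDelta n m (-g : ℤ) := by
  have h1 : (-(((2 * g - 1 : ℤ) : ℚ) + 1) / 2) = ((-g : ℤ) : ℚ) := by push_cast; ring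
  have h2 : cycDelta n m (((2 * g - 1 : ℤ) : ℚ) / 2 + k) = 0 := by
    unfold cycDelta
    rw [if_neg]
    rintro ⟨z, hz, -⟩
    have : ((2 * g - 1 + 2 * k : ℤ) : ℚ) = (2 * z : ℤ) := by
      push_cast at hz ⊢
      linarith
    have := Int.cast_injective this
    omega
  rw [eps, h1, h2, zero_add]

/-- The index modulo `n` of the summand of `W` computed by the diagonal `a - b = d`. -/
def diagIndex (k : ℕ) (m d : ℤ) : ℤ := if d % 2 = 0 then m - d / 2 else m + k + (d + 1) / 2

theorem sum_Icc_eq_sum_diagIndex {r n k : ℕ} (hn : r + k = n) (hpos : 0 < n) (m : ℤ) (w : ℤ → ℂ)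
    (hw : ∀ i c, w (i + n * c) = w i) :
    ∑ i ∈ Finset.Icc 1 n, w i = ∑ d ∈ Finset.Icc (-k : ℤ) (r - 1), w (diagIndex k m d) := by
  have hn' : (n : ℤ) ≠ 0 := by omega
  set f : ℤ → ℕ := fun d => ((diagIndex k m d - 1) % n).toNat + 1 with hf
  have hfeq (d : ℤ) : ∃ c, (f d : ℤ) = diagIndex k m d + n * c := by
    refine ⟨-((diagIndex k m d - 1) / n), ?_⟩
    have h1 := Int.emod_nonneg (diagIndex k m d - 1) hn'
    have h2 := Int.emod_add_mul_ediv (diagIndex k m d - 1) n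
    simp only [hf]
    push_cast
    rw [Int.toNat_of_nonneg h1, mul_neg]
    linarith
  have hmem (d : ℤ) : f d ∈ Finset.Icc 1 n := by
    have h1 := Int.emod_nonneg (diagIndex k m d - 1) hn'
    have h2 := Int.emod_lt_of_pos (diagIndex k m d - 1) (show (0 : ℤ) < n by omega)
    simp only [hf, Finset.mem_Icc]
    omega
  have hinj : Set.InjOn f (Finset.Icc (-k : ℤ) (r - 1)) := by
    intro d hd d' hd' h
    simp only [Finset.coe_Icc, Set.mem_Icc] at hd hd'
    obtain ⟨c, hc⟩ := hfeq d
    obtain ⟨c', hc'⟩ := hfeq d'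
    have h1 : diagIndex k m d - diagIndex k m d' = n * (c' - c) := by
      rw [mul_sub]
      have : (f d : ℤ) = f d' := by rw [h]
      linarith
    -- All indices lie in a window shorter than `n`, so congruent ones are equal.
    have h2 : diagIndex k m d - diagIndex k m d' < n ∧ -n < diagIndex k m d - diagIndex k m d' := by
      unfold diagIndex
      split_ifs <;> omega
    have h3 : c' - c = 0 := by
      have : c' - c < 1 := by nlinarith
      have : -1 < c' - c := by nlinarith
      omega
    rw [h3, mul_zero] at h1
    unfold diagIndex at h1
    split_ifs at h1 <;> omega
  have himage : (Finset.Icc (-k : ℤ) (r - 1)).image f = Finset.Icc 1 n := by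
    refine Finset.eq_of_subset_of_card_le (Finset.image_subset_iff.2 fun d _ => hmem d) ?_
    rw [Finset.card_image_of_injOn hinj, Int.card_Icc, Nat.card_Icc]
    omega
  rw [← himage, Finset.sum_image hinj]
  refine Finset.sum_congr rfl fun d _ => ?_
  obtain ⟨c, hc⟩ := hfeq d
  rw [hc, hw]

section Chart

variable {r n k : ℕ} {m : ℤ} {A : Matrix (Fin r) (Fin n) ℂ} {y : ℤ → ℤ → ℂ}

theorem diagSum_eq_frozenRatio (h : IsCheckboardChart k m A y) (hk : 1 ≤ k) (hr : 1 ≤ r) {d : ℤ}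
    (h₁ : 1 - k ≤ d) (h₂ : d ≤ r - 2) :
    diagSum₁ k n y d + diagSum₂ k n y d = frozenRatio k A (diagIndex k m d) := by
  obtain ⟨e, rfl | rfl⟩ : ∃ e, d = 2 * e ∨ d = 2 * e - 1 := ⟨(d + 1) / 2, by omega⟩
  · rw [diagSum_even h hk hr h₁ h₂, diagIndex, if_pos (by omega)]
    congr 1
    omega
  · rw [diagSum_odd h hk hr h₁ h₂, diagIndex, if_neg (by omega)]
    congr 1
    omega

theorem chart_div_eq_frozenRatio_first (h : IsCheckboardChart k m A y) (hk : 1 ≤ k) (hr : 1 ≤ r) :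
    y 1 (k - 1) / y 0 k = frozenRatio k A (diagIndex k m (-k)) := by
  have hn := h.add_eq
  rw [h.eq _ _ ((k + 1) / 2) (by unfold InGrid; omega) (by omega),
    h.eq _ _ ((k + 1) / 2) (by unfold InGrid; omega) (by omega)]
  have hi : diagIndex k m (-k) = m + (k + 1) / 2 := by
    unfold diagIndex
    split_ifs <;> omega
  rw [hi]
  apply cycPlucker_div_cycPlucker_eq_frozenRatio
  all_goals
    simp only [Finset.mem_union, Finset.mem_Ioc, Finset.mem_Icc, Finset.mem_singleton]
    omega

theorem chart_div_eq_frozenRatio_last (h : IsCheckboardChart k m A y) (hk : 1 ≤ k) (hr : 1 ≤ r) :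
    y (n - k - 1) 1 / y (n - k) 0 = frozenRatio k A (diagIndex k m (r - 1)) := by
  have hn := h.add_eq
  rw [h.eq _ _ ((r + 1) / 2) (by unfold InGrid; omega) (by omega),
    h.eq _ _ ((r + 1) / 2) (by unfold InGrid; omega) (by omega)]
  -- For even `r` the odd-diagonal formula applies and gives an index one full turn away.
  have hi : diagIndex k m (r - 1) = m - r / 2 ∨ diagIndex k m (r - 1) = m - r / 2 + n * 1 := by
    unfold diagIndex
    split_ifs <;> omega
  have hi' : frozenRatio k A (diagIndex k m (r - 1)) = frozenRatio k A (m - r / 2) := by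
    rcases hi with hi | hi <;> rw [hi]
    rw [frozenRatio_add_mul]
  rw [hi']
  apply cycPlucker_div_cycPlucker_eq_frozenRatio
  all_goals
    simp only [Finset.mem_union, Finset.mem_Ioc, Finset.mem_Icc, Finset.mem_singleton]
    omega

/-- Parity of `d` leaves one of the two deltas, and solving its congruence for `k` yields the index
of the diagonal. -/
theorem eps_eq (d : ℤ) [Decidable (diagIndex k m d ≡ k [ZMOD n])] :
    eps k n m d = if diagIndex k m d ≡ k [ZMOD n] then 1 else 0 := by
  classical
  obtain ⟨e, rfl | rfl⟩ : ∃ e, d = 2 * e ∨ d = 2 * e - 1 := ⟨(d + 1) / 2, by omega⟩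
  · rw [eps_even, cycDelta_intCast]
    refine if_congr ?_ rfl rfl
    rw [diagIndex, if_pos (by omega), Int.modEq_iff_dvd, Int.modEq_iff_dvd,
      show e + k - m = k - (m - 2 * e / 2) by omega]
  · rw [eps_odd, cycDelta_intCast]
    refine if_congr ?_ rfl rfl
    rw [diagIndex, if_neg (by omega), Int.modEq_iff_dvd, Int.modEq_iff_dvd,
      show -e - m = k - (m + k + (2 * e - 1 + 1) / 2) by omega]

theorem floor_div_two (z : ℤ) : ⌊(z : ℚ) / 2⌋ = z / 2 := by
  exact_mod_cast Rat.floor_intCast_div_natCast z 2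

theorem cycDelta_first [Decidable (diagIndex k m (-k) ≡ k [ZMOD n])] :
    cycDelta n m (⌊(k : ℚ) / 2⌋ : ℤ) = if diagIndex k m (-k) ≡ k [ZMOD n] then 1 else 0 := by
  classical
  have hfl : ⌊(k : ℚ) / 2⌋ = (k : ℤ) / 2 := by
    rw [← floor_div_two, Int.cast_natCast]
  rw [hfl, cycDelta_intCast]
  refine if_congr ?_ rfl rfl
  rw [Int.modEq_iff_dvd, Int.modEq_iff_dvd,
    show (k : ℤ) / 2 - m = k - diagIndex k m (-k) by unfold diagIndex; split_ifs <;> omega]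

theorem cycDelta_last (hn : r + k = n) [Decidable (diagIndex k m (r - 1) ≡ k [ZMOD n])] :
    cycDelta n m (⌊((n : ℚ) + k) / 2⌋ : ℤ) =
      if diagIndex k m (r - 1) ≡ k [ZMOD n] then 1 else 0 := by
  classical
  have hfl : ⌊((n : ℚ) + k) / 2⌋ = ((n : ℤ) + k) / 2 := by
    rw [← floor_div_two, Int.cast_add, Int.cast_natCast, Int.cast_natCast]
  rw [hfl, cycDelta_intCast]
  refine if_congr ?_ rfl rfl
  rw [Int.modEq_iff_dvd, Int.modEq_iff_dvd]
  rcases (by unfold diagIndex; split_ifs <;> omega :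
    ((n : ℤ) + k) / 2 - m = k - diagIndex k m (r - 1) ∨
      ((n : ℤ) + k) / 2 - m = k - diagIndex k m (r - 1) + n) with h | h <;> rw [h]
  simp

theorem sum_frozenRatio_mul_pow (h : IsCheckboardChart k m A y) (hk : 1 ≤ k) (hr : 1 ≤ r) (q : ℂ) :
    ∑ i ∈ Finset.Icc 1 n,
        plucker A (frozenLabelPlus n k i) / plucker A (frozenLabel n k i) *
          q ^ (if i = k then 1 else 0) =
      y 1 (k - 1) / y 0 k * q ^ cycDelta n m ⌊(k : ℚ) / 2⌋ +
        y (n - k - 1) 1 / y (n - k) 0 * q ^ cycDelta n m ⌊((n : ℚ) + k) / 2⌋ +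
        ∑ d ∈ Finset.Icc (1 - k : ℤ) (r - 2),
          (diagSum₁ k n y d + diagSum₂ k n y d) * q ^ eps k n m d := by
  classical
  have hn := h.add_eq
  -- The exponent is made `n`-periodic in `i` so that the sum can be reindexed modulo `n`.
  set w : ℤ → ℂ := fun i => frozenRatio k A i * q ^ (if i ≡ k [ZMOD n] then 1 else 0) with hw
  have hwper (i c : ℤ) : w (i + n * c) = w i := by
    simp only [hw, frozenRatio_add_mul]
    congr 2
    refine if_congr ?_ rfl rfl
    simp [Int.ModEq]
  have hsum : ∑ i ∈ Finset.Icc 1 n, plucker A (frozenLabelPlus n k i) /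
      plucker A (frozenLabel n k i) * q ^ (if i = k then 1 else 0) = ∑ i ∈ Finset.Icc 1 n, w i := by
    refine Finset.sum_congr rfl fun i hi => ?_
    simp only [hw, frozenRatio]
    congr 2
    refine if_congr ?_ rfl rfl
    rw [Finset.mem_Icc] at hi
    constructor
    · rintro rfl
      rfl
    · intro hik
      obtain ⟨c, hc⟩ := hik.dvd
      have : c = 0 := by
        have : c < 1 := by nlinarith
        have : -1 < c := by nlinarith
        omega
      subst this
      omega
  -- The extreme indices `-k` and `r - 1` carry the two corner quotients rather than telescoping
  -- sums.
  have hsplit : Finset.Icc (-k : ℤ) (r - 1) =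
      insert (-k : ℤ) (insert (r - 1 : ℤ) (Finset.Icc (1 - k : ℤ) (r - 2))) := by
    ext d
    simp only [Finset.mem_insert, Finset.mem_Icc]
    omega
  rw [hsum, sum_Icc_eq_sum_diagIndex hn (by omega) m w hwper, hsplit, Finset.sum_insert,
    Finset.sum_insert, ← add_assoc, chart_div_eq_frozenRatio_first h hk hr,
    chart_div_eq_frozenRatio_last h hk hr, cycDelta_first, cycDelta_last hn]
  · congr 1
    refine Finset.sum_congr rfl fun d hd => ?_
    rw [Finset.mem_Icc] at hd
    rw [diagSum_eq_frozenRatio h hk hr hd.1 hd.2, eps_eq]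
  · simp only [Finset.mem_Icc]
    omega
  · simp only [Finset.mem_insert, Finset.mem_Icc]
    omega

end Chart

end Checkboard

theorem mainTheorem8 (k n : ℕ) (hk : 2 ≤ k) (hkn : k + 2 ≤ n) (m : ℕ) (hm : m ∈ Finset.Icc 1 n) :
    -- the right labels of `σ^m ρ Ĝ` are the `σ^m ρ Ĵ_{j,i}`
    Checkboard.rightLabels
        (Checkboard.actGraph (Checkboard.rot n ^ m * Checkboard.refl n)
          (Checkboard.dualCheckboard n k)) =
      {J | ∃ i j : ℤ, Checkboard.InGrid k n i j ∧ J = Checkboard.reflLabel n k m i j} ∧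
    -- explicit form of these labels
    (∀ i j : ℤ, Checkboard.InGrid k n i j →
      Checkboard.reflLabel n k m i j =
        Checkboard.act (Checkboard.rot n ^ (Checkboard.halfCeil i j + m))
          (Checkboard.seg n (n - k - i) ∪
            (Checkboard.seg n (n - j) \ Checkboard.seg n (n - i - j)))) ∧
    -- the formula for `W`, for all representatives `A` of a point `V` of the Grassmannian
    ∀ (V : Checkboard.OpenGr k n) (q : ℂˣ) (A : Matrix (Fin (n - k)) (Fin n) ℂ) (y : ℤ → ℤ → ℂ),
      Checkboard.Represents A V.1 →
      (∀ i j : ℤ, y i j = Checkboard.plucker A (Checkboard.reflLabel n k m i j)) →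
      (∀ i j : ℤ, Checkboard.InGrid k n i j → y i j ≠ 0) →
      Checkboard.superpotential k n V q =
        y 1 (k - 1) / y 0 k * (q : ℂ) ^ Checkboard.cycDelta n m ⌊(k : ℚ) / 2⌋ +
        y (n - k - 1) 1 / y (n - k) 0 * (q : ℂ) ^ Checkboard.cycDelta n m ⌊((n : ℚ) + k) / 2⌋ +
        ∑ d ∈ Finset.Icc (1 - k : ℤ) (n - k - 2),
          (Checkboard.diagSum₁ k n y d + Checkboard.diagSum₂ k n y d) *
            (q : ℂ) ^ Checkboard.eps k n m d := by
  refine ⟨Checkboard.rightLabels_actGraph_dualCheckboard m,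
    fun i j h => Checkboard.reflLabel_eq_act m h, fun V q A y hA hy hy0 => ?_⟩
  have h : Checkboard.IsCheckboardChart k (m : ℤ) A y :=
    ⟨by omega, fun a b c hab hc => by
      rw [hy, Checkboard.reflLabel_eq_residues m hab hc, Checkboard.cycPlucker], hy0⟩
  rw [Checkboard.superpotential_eq V q hA, Checkboard.superpotentialOn,
    Checkboard.sum_frozenRatio_mul_pow h (by omega) (by omega), Nat.cast_sub (by omega)]
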